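/- Let $X$ be a Riemann surface (connected, Hausdorff) and let $\mathcal V$ be a holomorphic vector bundle of rank $n$ on $X$ with a projectively flat structure, i.e. holomorphic trivializations of $\mathcal V$ over the members of an open cover $\{U_i\}$ of $X$ whose transition functions have the form $\lambda_{ij}T_{ij}$ with $\lambda_{ij}:U_i\cap U_j\to\mathbb C^\times$ holomorphic and $T_{ij}\in GL_n(\mathbb C)$ constant. A projectively flat frame is a local holomorphic trivialization of $\mathcal V$ whose transition functions to the given trivializations are locally of this form. For a meromorphic section $A$ of $\mathcal V$ with components $(a_1,\dots,a_n)$ in a projectively flat frame and a holomorphic coordinate $z$, let $W(A)=\bigl(d^{i}a_j/dz^{i}\bigr)_{0\le i\le n-1,\,1\le j\le n}$ be its Wronskian matrix and $w(A)=\det W(A)$. Call $A$ generic if $w(A)\not\equiv 0$ in some such frame and coordinate, and for generic $B$ let $A/B=W(B)^{-1}W(A)$ locally. Then: 1. For every generic meromorphic section $A$ there is a unique divisor $\operatorname{div}(A)$ on $X$ that restricts to the divisor of the local meromorphic function $w(A)$ for every projectively flat frame and every holomorphic coordinate. 2. For any two generic meromorphic sections $A,B$ the local functions $w(A)/w(B)=\det(A/B)$,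 for all projectively flat frames and holomorphic coordinates, are the restrictions of one global meromorphic function on $X$, not identically zero, and its divisor is $\operatorname{div}(A)-\operatorname{div}(B)$. 3. The class of $\operatorname{div}(A)$ in the Picard group $\operatorname{Pic}(X)$ of holomorphic line bundles on $X$ (the isomorphism class of $\mathcal O(\operatorname{div}(A))$) does not depend on the generic meromorphic section $A$. 4. Consequently the Wronskian line bundle $w(\mathcal V)$ is well defined: if $\mathcal V$ has a generic meromorphic section, there is exactly one class in $\operatorname{Pic}(X)$ that equals the class of $\operatorname{div}(A)$ for every projectively flat structure on $\mathcal V$ and every meromorphic section $A$ generic with respect to it. -/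

import Mathlib

open Set Filter Topology Bundle
open scoped Manifold ContDiff

noncomputable section

namespace PFWronskian

/-! ### Divisors and meromorphic functions on a Riemann surface -/

/-- Divisors on `X`: integer valued functions on `X` with locally finite support. -/
abbrev Divisor (X : Type*) [TopologicalSpace X] := Function.locallyFinsupp X ℤ

section MeromorphicFunctions

variable {X : Type*} [TopologicalSpace X] [ChartedSpace ℂ X]

/-- A global meromorphic function on `X`. As for Mathlib's `MeromorphicAt`, the values at isolated
points carry no information. -/
def IsMeromorphicFunction (h : X → ℂ) : Prop :=
  ∀ x : X, MeromorphicAt (fun z : ℂ => h ((chartAt ℂ x).symm z)) (chartAt ℂ x x)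

/-- The order of vanishing of `h` at `x` (`⊤` if `h` vanishes identically near `x`). -/
def meromorphicOrder (h : X → ℂ) (x : X) : WithTop ℤ :=
  meromorphicOrderAt (fun z : ℂ => h ((chartAt ℂ x).symm z)) (chartAt ℂ x x)

/-- `h` is a meromorphic function on `X`, nowhere locally identically zero, with divisor `D`. -/
def HasDivisor (h : X → ℂ) (D : Divisor X) : Prop :=
  IsMeromorphicFunction h ∧ ∀ x : X, meromorphicOrder h x = ((D x : ℤ) : WithTop ℤ)

end MeromorphicFunctions

/-! ### The Picard group

`Pic X` is the group of isomorphism classes of holomorphic line bundles on `X`, given by transition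
cocycles, i.e. the Čech cohomology group `H¹(X, 𝒪ˣ)`. Every open cover has a refinement indexed
by the points of `X` such that the `x`-th member contains `x`, so such covers suffice. -/

section Picard

variable (X : Type*) [TopologicalSpace X] [ChartedSpace ℂ X]

/-- A holomorphic line bundle given by an open cover and transition functions `g x y`
on `U x ∩ U y`. -/
structure LineCocycle where
  U : X → Set X
  isOpen_U : ∀ x, IsOpen (U x)
  mem_U : ∀ x, x ∈ U x
  g : X → X → X → ℂ
  holomorphic : ∀ x y, ContMDiffOn 𝓘(ℂ, ℂ) 𝓘(ℂ, ℂ) ω (g x y) (U x ∩ U y)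
  ne_zero : ∀ x y, ∀ p ∈ U x ∩ U y, g x y p ≠ 0
  cocycle : ∀ x y z, ∀ p ∈ U x ∩ U y ∩ U z, g x y p * g y z p = g x z p

namespace LineCocycle

variable {X}

/-- Two cocycles define isomorphic line bundles: after passing to a common refinement `W` they
differ by the coboundary of nowhere vanishing holomorphic functions `h x` on `W x`. -/
def Equivalent (c d : LineCocycle X) : Prop :=
  ∃ (W : X → Set X) (h : X → X → ℂ),
    (∀ x, IsOpen (W x) ∧ x ∈ W x ∧ W x ⊆ c.U x ∩ d.U x) ∧
    (∀ x, ContMDiffOn 𝓘(ℂ, ℂ) 𝓘(ℂ, ℂ) ω (h x) (W x)) ∧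
    (∀ x, ∀ p ∈ W x, h x p ≠ 0) ∧
    ∀ x y, ∀ p ∈ W x ∩ W y, h x p * d.g x y p = c.g x y p * h y p

theorem Equivalent.refl (c : LineCocycle X) : Equivalent c c :=
  ⟨c.U, fun _ _ => 1, fun x => ⟨c.isOpen_U x, c.mem_U x, by simp⟩,
    fun _ => contMDiffOn_const, fun _ _ _ => one_ne_zero, fun _ _ _ _ => by ring⟩

theorem Equivalent.symm {c d : LineCocycle X} (H : Equivalent c d) : Equivalent d c := by
  obtain ⟨W, h, hW, hh, h0, hc⟩ := H
  refine ⟨W, fun x p => (h x p)⁻¹, fun x => ⟨(hW x).1, (hW x).2.1, ?_⟩,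
    fun x => (hh x).inv₀ (h0 x), fun x p hp => inv_ne_zero (h0 x p hp), ?_⟩
  · rw [inter_comm]
    exact (hW x).2.2
  · intro x y p hp
    have h1 := h0 x p hp.1
    have h2 := h0 y p hp.2
    have h3 := hc x y p hp
    field_simp
    linear_combination -h3

theorem Equivalent.trans {c d e : LineCocycle X} (H : Equivalent c d) (K : Equivalent d e) :
    Equivalent c e := by
  obtain ⟨W, h, hW, hh, h0, hc⟩ := H
  obtain ⟨V, k, hV, hk, k0, kc⟩ := K
  refine ⟨fun x => W x ∩ V x, fun x p => h x p * k x p,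
    fun x => ⟨(hW x).1.inter (hV x).1, ⟨(hW x).2.1, (hV x).2.1⟩, fun p hp =>
      ⟨((hW x).2.2 hp.1).1, ((hV x).2.2 hp.2).2⟩⟩,
    fun x => ((hh x).mono inter_subset_left).mul ((hk x).mono inter_subset_right),
    fun x p hp => mul_ne_zero (h0 x p hp.1) (k0 x p hp.2), ?_⟩
  intro x y p hp
  have h1 := hc x y p ⟨hp.1.1, hp.2.1⟩
  have h2 := kc x y p ⟨hp.1.2, hp.2.2⟩
  linear_combination h x p * h2 + k y p * h1

instance setoid : Setoid (LineCocycle X) where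
  r := Equivalent
  iseqv := ⟨Equivalent.refl, Equivalent.symm, Equivalent.trans⟩

/-- The trivial line bundle. -/
instance : One (LineCocycle X) where
  one :=
    { U := fun _ => univ
      isOpen_U := fun _ => isOpen_univ
      mem_U := fun _ => mem_univ _
      g := fun _ _ _ => 1
      holomorphic := fun _ _ => contMDiffOn_const
      ne_zero := fun _ _ _ _ => one_ne_zero
      cocycle := fun _ _ _ _ _ => one_mul 1 }

/-- The tensor product of line bundles. -/
instance : Mul (LineCocycle X) where
  mul c d :=
    { U := fun x => c.U x ∩ d.U x
      isOpen_U := fun x => (c.isOpen_U x).inter (d.isOpen_U x)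
      mem_U := fun x => ⟨c.mem_U x, d.mem_U x⟩
      g := fun x y p => c.g x y p * d.g x y p
      holomorphic := fun x y =>
        ((c.holomorphic x y).mono fun _ hp => ⟨hp.1.1, hp.2.1⟩).mul
          ((d.holomorphic x y).mono fun _ hp => ⟨hp.1.2, hp.2.2⟩)
      ne_zero := fun x y p hp =>
        mul_ne_zero (c.ne_zero x y p ⟨hp.1.1, hp.2.1⟩) (d.ne_zero x y p ⟨hp.1.2, hp.2.2⟩)
      cocycle := fun x y z p hp => by
        rw [← c.cocycle x y z p ⟨⟨hp.1.1.1, hp.1.2.1⟩, hp.2.1⟩,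
          ← d.cocycle x y z p ⟨⟨hp.1.1.2, hp.1.2.2⟩, hp.2.2⟩]
        ring }

/-- The dual line bundle. -/
instance : Inv (LineCocycle X) where
  inv c :=
    { U := c.U
      isOpen_U := c.isOpen_U
      mem_U := c.mem_U
      g := fun x y p => (c.g x y p)⁻¹
      holomorphic := fun x y => (c.holomorphic x y).inv₀ (c.ne_zero x y)
      ne_zero := fun x y p hp => inv_ne_zero (c.ne_zero x y p hp)
      cocycle := fun x y z p hp => by
        rw [← c.cocycle x y z p hp, mul_inv] }

/-- Cocycles with the same values on a common refinement are equivalent. -/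
theorem equivalent_of_eq {c d : LineCocycle X}
    (H : ∀ x y, ∀ p ∈ c.U x ∩ d.U x ∩ (c.U y ∩ d.U y), c.g x y p = d.g x y p) :
    Equivalent c d :=
  ⟨fun x => c.U x ∩ d.U x, fun _ _ => 1,
    fun x => ⟨(c.isOpen_U x).inter (d.isOpen_U x), ⟨c.mem_U x, d.mem_U x⟩, Subset.rfl⟩,
    fun _ => contMDiffOn_const, fun _ _ _ => one_ne_zero,
    fun x y p hp => by rw [H x y p hp]; ring⟩

theorem Equivalent.mul {c c' d d' : LineCocycle X} (H : Equivalent c c') (K : Equivalent d d') :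
    Equivalent (c * d) (c' * d') := by
  obtain ⟨W, h, hW, hh, h0, hc⟩ := H
  obtain ⟨V, k, hV, hk, k0, kc⟩ := K
  refine ⟨fun x => W x ∩ V x, fun x p => h x p * k x p,
    fun x => ⟨(hW x).1.inter (hV x).1, ⟨(hW x).2.1, (hV x).2.1⟩, fun p hp =>
      ⟨⟨((hW x).2.2 hp.1).1, ((hV x).2.2 hp.2).1⟩, ⟨((hW x).2.2 hp.1).2, ((hV x).2.2 hp.2).2⟩⟩⟩,
    fun x => ((hh x).mono inter_subset_left).mul ((hk x).mono inter_subset_right),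
    fun x p hp => mul_ne_zero (h0 x p hp.1) (k0 x p hp.2), ?_⟩
  intro x y p hp
  have h1 := hc x y p ⟨hp.1.1, hp.2.1⟩
  have h2 := kc x y p ⟨hp.1.2, hp.2.2⟩
  change h x p * k x p * (c'.g x y p * d'.g x y p) = c.g x y p * d.g x y p * (h y p * k y p)
  linear_combination h x p * c'.g x y p * h2 + d.g x y p * k y p * h1

theorem Equivalent.inv {c d : LineCocycle X} (H : Equivalent c d) : Equivalent c⁻¹ d⁻¹ := by
  obtain ⟨W, h, hW, hh, h0, hc⟩ := H
  refine ⟨W, fun x p => (h x p)⁻¹, hW,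
    fun x => (hh x).inv₀ (h0 x), fun x p hp => inv_ne_zero (h0 x p hp), ?_⟩
  intro x y p hp
  change (h x p)⁻¹ * (d.g x y p)⁻¹ = (c.g x y p)⁻¹ * (h y p)⁻¹
  rw [← mul_inv, ← mul_inv, hc x y p hp]

end LineCocycle

/-- The Picard group of `X`: isomorphism classes of holomorphic line bundles. -/
def Pic : Type _ := Quotient (LineCocycle.setoid (X := X))

instance : CommGroup (Pic X) where
  mul := Quotient.map₂ (· * ·) fun _ _ H _ _ K => LineCocycle.Equivalent.mul H K
  one := Quotient.mk _ 1
  inv := Quotient.map (·⁻¹) fun _ _ H => LineCocycle.Equivalent.inv H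
  mul_assoc a b c := by
    induction a using Quotient.inductionOn
    induction b using Quotient.inductionOn
    induction c using Quotient.inductionOn
    exact Quotient.sound (LineCocycle.equivalent_of_eq fun _ _ _ _ => mul_assoc _ _ _)
  one_mul a := by
    induction a using Quotient.inductionOn
    exact Quotient.sound (LineCocycle.equivalent_of_eq fun _ _ _ _ => one_mul _)
  mul_one a := by
    induction a using Quotient.inductionOn
    exact Quotient.sound (LineCocycle.equivalent_of_eq fun _ _ _ _ => mul_one _)
  inv_mul_cancel a := by
    induction a using Quotient.inductionOn with | _ c
    exact Quotient.sound (LineCocycle.equivalent_of_eq fun x y p hp =>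
      inv_mul_cancel₀ (c.ne_zero x y p ⟨hp.1.1.1, hp.2.1.1⟩))
  mul_comm a b := by
    induction a using Quotient.inductionOn
    induction b using Quotient.inductionOn
    exact Quotient.sound (LineCocycle.equivalent_of_eq fun _ _ _ _ => mul_comm _ _)

variable {X}

namespace Divisor

/-- A neighbourhood of `x`, inside a chart domain, on which `D` is supported at most at `x`. -/
def nbhd (D : Divisor X) (x : X) : Set X :=
  {p | p ∈ (chartAt ℂ x).source ∧ (p = x ∨ D p = 0)}

/-- The local equation `(φ - φ x) ^ D x` of `D` on `D.nbhd x`, with `φ` the chart at `x`. -/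
def localEquation (D : Divisor X) (x p : X) : ℂ :=
  (chartAt ℂ x p - chartAt ℂ x x) ^ (D x)

theorem isOpen_nbhd [T1Space X] (D : Divisor X) (x : X) : IsOpen (D.nbhd x) := by
  rw [isOpen_iff_mem_nhds]
  rintro p ⟨hp, hpx⟩
  obtain ⟨t, ht, hfin⟩ := D.supportLocallyFiniteWithinDomain p (mem_univ p)
  have hfin' : ((t ∩ D.support) \ {p} : Set X).Finite := hfin.subset sdiff_subset
  have hO : ((t ∩ D.support) \ {p} : Set X)ᶜ ∈ 𝓝 p :=
    hfin'.isClosed.isOpen_compl.mem_nhds fun h => h.2 rfl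
  filter_upwards [ht, hO, (chartAt ℂ x).open_source.mem_nhds hp] with q hq hq' hqs
  refine ⟨hqs, ?_⟩
  by_cases hqp : q = p
  · rw [hqp]; exact hpx
  · right
    by_contra h0
    exact hq' ⟨⟨hq, h0⟩, hqp⟩

theorem localEquation_ne_zero (D : Divisor X) {x p : X} (hp : p ∈ D.nbhd x)
    (h : p ≠ x ∨ D x = 0) : D.localEquation x p ≠ 0 := by
  unfold localEquation
  rcases h with h | h
  · refine zpow_ne_zero _ (sub_ne_zero.2 fun he => h ?_)
    exact (chartAt ℂ x).injOn hp.1 (mem_chart_source ℂ x) he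
  · simp [h]

theorem contMDiffOn_localEquation [IsManifold 𝓘(ℂ, ℂ) ω X] (D : Divisor X) (x : X) {s : Set X}
    (hs : s ⊆ D.nbhd x) (h : x ∉ s ∨ D x = 0) :
    ContMDiffOn 𝓘(ℂ, ℂ) 𝓘(ℂ, ℂ) ω (D.localEquation x) s := by
  have hchart : ContMDiffOn 𝓘(ℂ, ℂ) 𝓘(ℂ, ℂ) ω (fun p => chartAt ℂ x p - chartAt ℂ x x) s :=
    ((contMDiffOn_chart (I := 𝓘(ℂ, ℂ)) (n := ω) (x := x)).mono fun p hp => (hs hp).1).sub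
      contMDiffOn_const
  rcases h with h | h
  · have hne : ∀ p ∈ s, chartAt ℂ x p - chartAt ℂ x x ≠ 0 := fun p hp =>
      sub_ne_zero.2 fun he => h <| by
        rwa [← (chartAt ℂ x).injOn (hs hp).1 (mem_chart_source ℂ x) he]
    unfold localEquation
    cases D x with
    | ofNat m => simpa using hchart.pow m
    | negSucc m =>
      simpa [zpow_negSucc] using (hchart.pow (m + 1)).inv₀ fun p hp => pow_ne_zero _ (hne p hp)
  · have : D.localEquation x = fun _ => 1 := by
      funext p; simp [localEquation, h]
    rw [this]
    exact contMDiffOn_const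

theorem eq_zero_of_mem_nbhd (D : Divisor X) {x y : X} (hxy : x ≠ y) (h : x ∈ D.nbhd y) :
    D x = 0 := h.2.resolve_left hxy

theorem ne_or_eq_zero (D : Divisor X) {x y p : X} (hxy : x ≠ y) (hp : p ∈ D.nbhd y) :
    p ≠ x ∨ D x = 0 := by
  by_cases h : p = x
  · exact Or.inr (D.eq_zero_of_mem_nbhd hxy (h ▸ hp))
  · exact Or.inl h

open Classical in
/-- The line bundle `𝒪(D)`: its transition functions are the quotients of the local equations of
`D` (these have no zeros or poles on the overlaps; the diagonal functions are `1`). -/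
def lineCocycle [T1Space X] [IsManifold 𝓘(ℂ, ℂ) ω X] (D : Divisor X) : LineCocycle X where
  U := D.nbhd
  isOpen_U := D.isOpen_nbhd
  mem_U x := ⟨mem_chart_source ℂ x, Or.inl rfl⟩
  g x y p := if x = y then 1 else D.localEquation x p / D.localEquation y p
  holomorphic x y := by
    by_cases hxy : x = y
    · simpa [hxy] using contMDiffOn_const
    · simp only [if_neg hxy]
      refine (D.contMDiffOn_localEquation x inter_subset_left ?_).div₀
        (D.contMDiffOn_localEquation y inter_subset_right ?_) fun p hp =>
          D.localEquation_ne_zero hp.2 (D.ne_or_eq_zero (Ne.symm hxy) hp.1)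
      · by_cases h : x ∈ D.nbhd x ∩ D.nbhd y
        · exact Or.inr (D.eq_zero_of_mem_nbhd hxy h.2)
        · exact Or.inl h
      · by_cases h : y ∈ D.nbhd x ∩ D.nbhd y
        · exact Or.inr (D.eq_zero_of_mem_nbhd (Ne.symm hxy) h.1)
        · exact Or.inl h
  ne_zero x y p hp := by
    by_cases hxy : x = y
    · simp [hxy]
    · simp only [if_neg hxy]
      exact div_ne_zero (D.localEquation_ne_zero hp.1 (D.ne_or_eq_zero hxy hp.2))
        (D.localEquation_ne_zero hp.2 (D.ne_or_eq_zero (Ne.symm hxy) hp.1))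
  cocycle x y z p hp := by
    by_cases hxy : x = y
    · simp [hxy]
    by_cases hyz : y = z
    · simp [hyz]
    have hx := D.localEquation_ne_zero hp.1.1 (D.ne_or_eq_zero hxy hp.1.2)
    have hy := D.localEquation_ne_zero hp.1.2 (D.ne_or_eq_zero hyz hp.2)
    have hz := D.localEquation_ne_zero hp.2 (D.ne_or_eq_zero (Ne.symm hyz) hp.1.2)
    by_cases hxz : x = z
    · subst hxz
      simp only [if_neg hxy, if_neg hyz, if_true]
      field_simp
    · simp only [if_neg hxy, if_neg hyz, if_neg hxz]
      field_simp

/-- The class of the divisor `D` in the Picard group, i.e. the class of the line bundle `𝒪(D)`. -/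
def picClass [T1Space X] [IsManifold 𝓘(ℂ, ℂ) ω X] (D : Divisor X) : Pic X :=
  Quotient.mk _ D.lineCocycle

end Divisor

end Picard

/-! ### Projectively flat structures, meromorphic sections, Wronskians -/

section Wronskian

variable {X : Type*} [TopologicalSpace X] [ChartedSpace ℂ X] {n : ℕ}
  {E : X → Type*} [∀ x, AddCommGroup (E x)] [∀ x, Module ℂ (E x)] [∀ x, TopologicalSpace (E x)]
  [TopologicalSpace (TotalSpace (Fin n → ℂ) E)] [FiberBundle (Fin n → ℂ) E]

/-- `e` is a holomorphic local trivialization of the bundle `E`: it is fibrewise linear and the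
transition matrices to the trivializations of the bundle atlas are holomorphic. -/
structure IsHolomorphicFrame
    (e : Trivialization (Fin n → ℂ) (π (Fin n → ℂ) E)) : Prop where
  linear : e.IsLinear ℂ
  holomorphic : ∀ e' ∈ trivializationAtlas (Fin n → ℂ) E, ∃ g : X → Matrix (Fin n) (Fin n) ℂ,
    (∀ i j, ContMDiffOn 𝓘(ℂ, ℂ) 𝓘(ℂ, ℂ) ω (fun x => g x i j) (e.baseSet ∩ e'.baseSet)) ∧
    ∀ x ∈ e.baseSet ∩ e'.baseSet, ∀ v : E x,
      (e' (TotalSpace.mk x v)).2 = (g x).mulVec (e (TotalSpace.mk x v)).2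

/-- On the subset `s` of `X`, the transition function from `e` to `e'` is of the form `c • T` with
`c` a nowhere vanishing holomorphic function and `T` a constant invertible matrix. -/
def ProjFlatTransitionOn
    (e e' : Trivialization (Fin n → ℂ) (π (Fin n → ℂ) E)) (s : Set X) : Prop :=
  ∃ (c : X → ℂ) (T : GL (Fin n) ℂ),
    ContMDiffOn 𝓘(ℂ, ℂ) 𝓘(ℂ, ℂ) ω c s ∧ (∀ x ∈ s, c x ≠ 0) ∧
    ∀ x ∈ s, ∀ v : E x, (e' (TotalSpace.mk x v)).2 =
      c x • (T : Matrix (Fin n) (Fin n) ℂ).mulVec (e (TotalSpace.mk x v)).2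

variable (n E) in
/-- A projectively flat structure on the bundle `E`: holomorphic trivializations over the members
of an open cover of `X` whose transition functions are (scalar function) × (constant matrix).
The bundle `E` is projectively flat if it has such a structure. -/
structure ProjFlatStructure where
  atlas : Set (Trivialization (Fin n → ℂ) (π (Fin n → ℂ) E))
  isHolomorphicFrame : ∀ e ∈ atlas, IsHolomorphicFrame e
  cover : ∀ x : X, ∃ e ∈ atlas, x ∈ e.baseSet
  transition : ∀ e ∈ atlas, ∀ e' ∈ atlas, ProjFlatTransitionOn e e' (e.baseSet ∩ e'.baseSet)

/-- `e` is a projectively flat local frame: a holomorphic trivialization which, locally,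
has projectively flat transitions to the members of the given atlas. -/
structure ProjFlatStructure.IsFrame (P : ProjFlatStructure n E)
    (e : Trivialization (Fin n → ℂ) (π (Fin n → ℂ) E)) : Prop where
  isHolomorphicFrame : IsHolomorphicFrame e
  transition : ∀ e' ∈ P.atlas, ∀ x ∈ e.baseSet ∩ e'.baseSet,
    ∃ s ⊆ e.baseSet ∩ e'.baseSet, IsOpen s ∧ x ∈ s ∧ ProjFlatTransitionOn e e' s

theorem ProjFlatStructure.isFrame_of_mem (P : ProjFlatStructure n E)
    {e : Trivialization (Fin n → ℂ) (π (Fin n → ℂ) E)} (he : e ∈ P.atlas) : P.IsFrame e :=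
  ⟨P.isHolomorphicFrame e he, fun e' he' _ hx =>
    ⟨_, Subset.rfl, e.open_baseSet.inter e'.open_baseSet, hx, P.transition e he e' he'⟩⟩

/-- The components of the section `A` in the frame `e` as functions of the coordinate `φ`. -/
def localRep (e : Trivialization (Fin n → ℂ) (π (Fin n → ℂ) E)) (φ : OpenPartialHomeomorph X ℂ)
    (A : ∀ x, E x) (z : ℂ) : Fin n → ℂ :=
  (e (TotalSpace.mk (φ.symm z) (A (φ.symm z)))).2

/-- A meromorphic section of the bundle `E`: its local components are meromorphic functions.
The values at isolated points carry no information. -/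
def IsMeromorphicSection (A : ∀ x, E x) : Prop :=
  ∀ x : X, MeromorphicAt (localRep (trivializationAt (Fin n → ℂ) E x) (chartAt ℂ x) A)
    (chartAt ℂ x x)

/-- The Wronskian matrix of `a = (a₁, …, aₙ)`: its `i`-th row (`i = 0, …, n - 1`) consists of the
`i`-th derivatives of the components. -/
def wronskianMatrix (a : ℂ → Fin n → ℂ) (z : ℂ) : Matrix (Fin n) (Fin n) ℂ :=
  Matrix.of fun i j => iteratedDeriv (i : ℕ) (fun w => a w j) z

/-- The Wronskian matrix `W(A)` in the frame `e` and the coordinate `φ`. -/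
def localWronskianMatrix (e : Trivialization (Fin n → ℂ) (π (Fin n → ℂ) E))
    (φ : OpenPartialHomeomorph X ℂ) (A : ∀ x, E x) (z : ℂ) : Matrix (Fin n) (Fin n) ℂ :=
  wronskianMatrix (localRep e φ A) z

/-- The Wronskian determinant `w(A)` in the frame `e` and the coordinate `φ`. -/
def localWronskian (e : Trivialization (Fin n → ℂ) (π (Fin n → ℂ) E))
    (φ : OpenPartialHomeomorph X ℂ) (A : ∀ x, E x) (z : ℂ) : ℂ :=
  (localWronskianMatrix e φ A z).det

/-- The Wronskian quotient `A / B = W(B)⁻¹ W(A)` in the frame `e` and the coordinate `φ`. -/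
def localQuotient (e : Trivialization (Fin n → ℂ) (π (Fin n → ℂ) E))
    (φ : OpenPartialHomeomorph X ℂ) (A B : ∀ x, E x) (z : ℂ) : Matrix (Fin n) (Fin n) ℂ :=
  (localWronskianMatrix e φ B z)⁻¹ * localWronskianMatrix e φ A z

/-- `A` is a generic meromorphic section: `A` is meromorphic and its Wronskian determinant in some
projectively flat frame and holomorphic coordinate does not vanish identically (as a meromorphic
function, near some point). -/
def ProjFlatStructure.IsGeneric (P : ProjFlatStructure n E) (A : ∀ x, E x) : Prop :=
  IsMeromorphicSection (n := n) A ∧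
    ∃ e, P.IsFrame e ∧ ∃ φ ∈ IsManifold.maximalAtlas 𝓘(ℂ, ℂ) ω X, ∃ x ∈ e.baseSet ∩ φ.source,
      meromorphicOrderAt (localWronskian e φ A) (φ x) ≠ ⊤

/-- `D` is the divisor of the Wronskian determinant of `A`: for every projectively flat frame `e`
and every holomorphic coordinate `φ`, the local function `w(A)` is meromorphic and its order at
each point of their common domain is the multiplicity of `D` there. -/
def ProjFlatStructure.IsWronskianDivisor (P : ProjFlatStructure n E) (A : ∀ x, E x)
    (D : Divisor X) : Prop :=
  ∀ e, P.IsFrame e → ∀ φ ∈ IsManifold.maximalAtlas 𝓘(ℂ, ℂ) ω X, ∀ x ∈ e.baseSet ∩ φ.source,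
    MeromorphicAt (localWronskian e φ A) (φ x) ∧
      meromorphicOrderAt (localWronskian e φ A) (φ x) = ((D x : ℤ) : WithTop ℤ)

end Wronskian

end PFWronskian

end

open PFWronskian

open PFWronskian

/-! Suppose `b = c • T (a ∘ ψ)` with `T` a constant matrix. The `i`-th derivative of `c * (f ∘ ψ)`
is a combination of the derivatives of `f` of order at most `i`, with leading coefficient `c * ψ' ^
i`. Hence the Wronskian matrix of `b` is `M * W(a) * Tᵀ`, with `W(a)` taken at `ψ z` and `M` lower
triangular. In the determinant all derivatives of `c` disappear, and `w(b)` is `w(a)` times `det (c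
• T)` times the power `n (n - 1) / 2` of `ψ'` (`det_wronskianMatrix_transition`). So `w(A)` behaves
as a meromorphic section of `det E ⊗ K ^ (n (n - 1) / 2)`.

The transition factor is holomorphic without zeros, so the order of `w(A)` at a point depends on
neither frame nor coordinate. On a connected surface the identity theorem makes these orders finite
everywhere once one of them is (`IsGeneric.wronskianOrder_ne_top`), and they form the divisor.

Two such sections have a meromorphic function as quotient. This remains true for sections generic
for two different structures `P` and `Q`: the target line bundle involves only `det E` and the
canonical bundle `K`, and a change from a `P`-frame to a `Q`-frame enters through its determinant
alone (`IsFrame.eventually_wronskianQuotient_eq`). Finally, a meromorphic function with divisor `D -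
D'` turns local equations of `D'` into local equations of `D` up to units, which identifies `𝒪(D)`
with `𝒪(D')` (`HasDivisor.picClass_eq`). -/

namespace PFWronskian

/-! ### Wronskians in one variable: change of coordinate and of frame -/

/-- The coefficients expressing the derivatives of `c * (f ∘ ψ)` through those of `f`:
the `i`-th derivative is `∑ k, transitionCoeff c ψ i k * (iteratedDeriv k f ∘ ψ)`. -/
noncomputable def transitionCoeff (c ψ : ℂ → ℂ) : ℕ → ℕ → ℂ → ℂ
  | 0, 0 => c
  | 0, _ + 1 => fun _ => 0
  | i + 1, 0 => deriv (transitionCoeff c ψ i 0)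
  | i + 1, k + 1 => fun z =>
      deriv (transitionCoeff c ψ i (k + 1)) z + deriv ψ z * transitionCoeff c ψ i k z

theorem analyticAt_transitionCoeff {c ψ : ℂ → ℂ} {z : ℂ} (hc : AnalyticAt ℂ c z)
    (hψ : AnalyticAt ℂ ψ z) (i k : ℕ) : AnalyticAt ℂ (transitionCoeff c ψ i k) z := by
  induction i generalizing k with
  | zero =>
    cases k with
    | zero => exact hc
    | succ k => exact analyticAt_const
  | succ i ih =>
    cases k with
    | zero => exact (ih 0).deriv
    | succ k => exact (ih (k + 1)).deriv.add (hψ.deriv.mul (ih k))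

theorem transitionCoeff_eq_zero {c ψ : ℂ → ℂ} {i k : ℕ} (h : i < k) :
    transitionCoeff c ψ i k = fun _ => 0 := by
  induction i generalizing k with
  | zero =>
    cases k with
    | zero => omega
    | succ k => rfl
  | succ i ih =>
    cases k with
    | zero => omega
    | succ k =>
      funext z
      simp [transitionCoeff, ih (show i < k + 1 by omega), ih (show i < k by omega)]

/-- Order `i` is reached in `i` differentiations only if each of them falls on `f ∘ ψ`, so no
derivative of `c` enters the diagonal. -/
theorem transitionCoeff_self (c ψ : ℂ → ℂ) (i : ℕ) (z : ℂ) :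
    transitionCoeff c ψ i i z = c z * deriv ψ z ^ i := by
  induction i with
  | zero => simp [transitionCoeff]
  | succ i ih =>
    simp only [transitionCoeff, ih, transitionCoeff_eq_zero (Nat.lt_succ_self i), deriv_const]
    ring

/-- An equality of germs, so that the induction can differentiate it. The length `N` of the sum is
independent of `i`, so that all rows `i < n` fit into one square matrix. -/
theorem iteratedDeriv_mul_comp_eventuallyEq {c ψ f : ℂ → ℂ} {z : ℂ} (hc : AnalyticAt ℂ c z)
    (hψ : AnalyticAt ℂ ψ z) (hf : AnalyticAt ℂ f (ψ z)) {i N : ℕ} (hi : i < N) :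
    iteratedDeriv i (fun w => c w * f (ψ w)) =ᶠ[𝓝 z] fun w =>
      ∑ k ∈ Finset.range N, transitionCoeff c ψ i k w * iteratedDeriv k f (ψ w) := by
  induction i with
  | zero =>
    obtain ⟨N, rfl⟩ := Nat.exists_eq_succ_of_ne_zero hi.ne'
    refine .of_forall fun w => ?_
    simp only [Finset.sum_range_succ', iteratedDeriv_zero, transitionCoeff, zero_mul,
      Finset.sum_const_zero, zero_add]
  | succ i ih =>
    obtain ⟨N, rfl⟩ := Nat.exists_eq_succ_of_ne_zero (show N ≠ 0 by omega)
    rw [iteratedDeriv_succ]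
    refine (ih (by omega)).deriv.trans ?_
    filter_upwards [hc.eventually_analyticAt, hψ.eventually_analyticAt,
      hψ.continuousAt.eventually hf.eventually_analyticAt] with w hcw hψw hfw
    have hder (k : ℕ) : HasDerivAt
        (fun u => transitionCoeff c ψ i k u * iteratedDeriv k f (ψ u))
        (deriv (transitionCoeff c ψ i k) w * iteratedDeriv k f (ψ w) +
          transitionCoeff c ψ i k w * (iteratedDeriv (k + 1) f (ψ w) * deriv ψ w)) w := by
      have h1 := (analyticAt_transitionCoeff hcw hψw i k).differentiableAt.hasDerivAt
      have h2 := (hfw.iterated_deriv k).differentiableAt.hasDerivAt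
      rw [← iteratedDeriv_eq_iterate, ← iteratedDeriv_succ] at h2
      exact h1.mul (h2.comp w hψw.differentiableAt.hasDerivAt)
    have hd := HasDerivAt.fun_sum (u := Finset.range (N + 1)) fun k _ => hder k
    -- The chain rule terms are shifted by one index; the top one, with the derivative of order `N +
    -- 1`, has coefficient zero because `i < N`.
    rw [hd.deriv, Finset.sum_add_distrib, Finset.sum_range_succ',
      Finset.sum_range_succ (fun k => transitionCoeff c ψ i k w * _),
      Finset.sum_range_succ' (fun k => transitionCoeff c ψ (i + 1) k w * _),
      transitionCoeff_eq_zero (show i < N by omega)]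
    simp only [transitionCoeff, zero_mul, add_zero, add_mul, Finset.sum_add_distrib]
    rw [add_right_comm]
    congr 2
    exact Finset.sum_congr rfl fun k _ => by ring

theorem iteratedDeriv_sum_const_mul {ι : Type*} (s : Finset ι) (T : ι → ℂ) (a : ι → ℂ → ℂ) {z : ℂ}
    (ha : ∀ j ∈ s, AnalyticAt ℂ (a j) z) (k : ℕ) :
    iteratedDeriv k (fun w => ∑ j ∈ s, T j * a j w) z = ∑ j ∈ s, T j * iteratedDeriv k (a j) z := by
  rw [iteratedDeriv_fun_sum (f := fun j w => T j * a j w) fun j hj =>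
    (analyticAt_const.mul (ha j hj)).contDiffAt]
  exact Finset.sum_congr rfl fun j hj => iteratedDeriv_const_mul_field _ _

/-- The transformation rule of the Wronskian determinant under a change of coordinates `ψ`,
multiplication by a function `c` and by a constant matrix `T`. -/
theorem det_wronskianMatrix_transition {n : ℕ} {a b : ℂ → Fin n → ℂ} {c ψ : ℂ → ℂ} {z : ℂ}
    (T : Matrix (Fin n) (Fin n) ℂ) (hc : AnalyticAt ℂ c z) (hψ : AnalyticAt ℂ ψ z)
    (ha : ∀ j, AnalyticAt ℂ (fun w => a w j) (ψ z))
    (hab : ∀ᶠ w in 𝓝 z, b w = c w • T.mulVec (a (ψ w))) :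
    (wronskianMatrix b z).det = (c z • T).det * (∏ i : Fin n, deriv ψ z ^ (i : ℕ)) *
      (wronskianMatrix a (ψ z)).det := by
  set M : Matrix (Fin n) (Fin n) ℂ := Matrix.of fun i k => transitionCoeff c ψ i k z
  have hM : M.det = ∏ i : Fin n, (c z * deriv ψ z ^ (i : ℕ)) := by
    rw [Matrix.det_of_isLowerTriangular M fun i j hij => ?_]
    · exact Finset.prod_congr rfl fun i _ => transitionCoeff_self _ _ _ _
    · change transitionCoeff c ψ i j z = 0
      rw [transitionCoeff_eq_zero]
      exact hij
  -- Row operations come from `c` and `ψ`, column operations from `T`; only the constancy of `T`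
  -- keeps the latter free of derivatives.
  have hW : wronskianMatrix b z = M * wronskianMatrix a (ψ z) * T.transpose := by
    ext i j
    have h1 : (fun w => b w j) =ᶠ[𝓝 z] fun w =>
        c w * (fun u => ∑ k, T j k * a u k) (ψ w) := by
      filter_upwards [hab] with w hw
      rw [hw]
      simp [Matrix.mulVec, dotProduct]
    have hf : AnalyticAt ℂ (fun u => ∑ k, T j k * a u k) (ψ z) :=
      Finset.analyticAt_fun_sum _ fun k _ => analyticAt_const.mul (ha k)
    have h2 := (iteratedDeriv_mul_comp_eventuallyEq hc hψ hf i.2).eq_of_nhds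
    have h3 := (h1.iteratedDeriv_eq (n := (i : ℕ)))
    simp only [wronskianMatrix, Matrix.of_apply]
    rw [h3, h2, Matrix.mul_assoc, Matrix.mul_apply, Finset.sum_range]
    refine Finset.sum_congr rfl fun k _ => ?_
    rw [iteratedDeriv_sum_const_mul _ (T j) (fun k u => a u k) fun k _ => ha k]
    simp only [M, Matrix.of_apply, Matrix.mul_apply, Matrix.transpose_apply]
    congr 1
    exact Finset.sum_congr rfl fun l _ => mul_comm _ _
  rw [hW, Matrix.det_mul, Matrix.det_mul, hM, Matrix.det_transpose, Matrix.det_smul,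
    Finset.prod_mul_distrib]
  simp
  ring

theorem analyticAt_det {n : ℕ} {M : ℂ → Matrix (Fin n) (Fin n) ℂ} {z : ℂ}
    (h : ∀ i j, AnalyticAt ℂ (fun w => M w i j) z) : AnalyticAt ℂ (fun w => (M w).det) z := by
  simp only [Matrix.det_apply']
  exact Finset.analyticAt_fun_sum _ fun σ _ => analyticAt_const.mul
    (Finset.analyticAt_fun_prod _ fun i _ => h _ _)

theorem analyticAt_inv_matrix {n : ℕ} {M : ℂ → Matrix (Fin n) (Fin n) ℂ} {z : ℂ}
    (h : ∀ i j, AnalyticAt ℂ (fun w => M w i j) z) (h0 : (M z).det ≠ 0) (i j : Fin n) :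
    AnalyticAt ℂ (fun w => (M w)⁻¹ i j) z := by
  simp only [Matrix.inv_def, Matrix.smul_apply, smul_eq_mul, Matrix.adjugate_apply,
    Ring.inverse_eq_inv']
  refine ((analyticAt_det h).inv h0).mul (analyticAt_det fun k l => ?_)
  -- An adjugate entry is the determinant of `M w` with row `j` replaced by a constant basis vector.
  by_cases hk : k = j
  · subst hk
    simpa using analyticAt_const
  · simpa [Matrix.updateRow_ne hk] using h k l

theorem meromorphicAt_det_wronskianMatrix {n : ℕ} {a : ℂ → Fin n → ℂ} {z : ℂ}
    (ha : ∀ j, MeromorphicAt (fun w => a w j) z) :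
    MeromorphicAt (fun w => (wronskianMatrix a w).det) z := by
  simp only [Matrix.det_apply', wronskianMatrix, Matrix.of_apply]
  refine MeromorphicAt.fun_sum fun σ _ => (MeromorphicAt.const _ _).mul
    (MeromorphicAt.fun_prod fun i _ => ?_)
  simpa [iteratedDeriv_eq_iterate] using (ha i).iterated_deriv

/-- A nonzero meromorphic germ has order `0` at all nearby points. -/
theorem eventually_meromorphicOrderAt_eq_zero {f : ℂ → ℂ} {z : ℂ} (hf : MeromorphicAt f z)
    (h : meromorphicOrderAt f z ≠ ⊤) : ∀ᶠ w in 𝓝[≠] z, meromorphicOrderAt f w = 0 := by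
  filter_upwards [hf.eventually_analyticAt,
    (meromorphicOrderAt_ne_top_iff_eventually_ne_zero hf).1 h] with w hw h0
  rw [hw.meromorphicOrderAt_eq, hw.analyticOrderAt_eq_zero.2 h0]
  rfl

/-! ### Meromorphic functions in holomorphic coordinates -/

section Charts

variable {X : Type*} [TopologicalSpace X]

theorem eventually_nhdsNE_symm_iff (φ : OpenPartialHomeomorph X ℂ) {x : X} (hx : x ∈ φ.source)
    {p : X → Prop} : (∀ᶠ z in 𝓝[≠] φ x, p (φ.symm z)) ↔ ∀ᶠ q in 𝓝[≠] x, p q := by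
  simp only [eventually_nhdsWithin_iff]
  rw [φ.eventually_nhds _ hx]
  refine eventually_congr ?_
  filter_upwards [φ.open_source.mem_nhds hx] with q hq
  simp [φ.left_inv hq, φ.injOn.eq_iff hq hx]

theorem eventually_nhdsNE_iff (φ : OpenPartialHomeomorph X ℂ) {x : X} (hx : x ∈ φ.source)
    {p : ℂ → Prop} : (∀ᶠ z in 𝓝[≠] φ x, p z) ↔ ∀ᶠ q in 𝓝[≠] x, p (φ q) := by
  simp only [eventually_nhdsWithin_iff]
  rw [φ.eventually_nhds _ hx]
  refine eventually_congr ?_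
  filter_upwards [φ.open_source.mem_nhds hx] with q hq
  simp [φ.injOn.eq_iff hq hx]

theorem eventually_symm_mem {φ' : OpenPartialHomeomorph X ℂ} {x : X} (hx' : x ∈ φ'.source)
    {s : Set X} (hs : s ∈ 𝓝 x) :
    ∀ᶠ z in 𝓝 (φ' x), φ'.symm z ∈ s :=
  (φ'.eventually_nhds' (· ∈ s) hx').2 hs

theorem comp_symm_eventuallyEq {φ φ' : OpenPartialHomeomorph X ℂ} {x : X}
    (hx : x ∈ φ.source) (hx' : x ∈ φ'.source) (f : X → ℂ) :
    (fun z => f (φ'.symm z)) =ᶠ[𝓝 (φ' x)]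
      (fun z => f (φ.symm z)) ∘ fun z => φ (φ'.symm z) := by
  filter_upwards [eventually_symm_mem hx' (φ.open_source.mem_nhds hx)] with z hz
  simp [φ.left_inv hz]

variable [ChartedSpace ℂ X]

theorem nhdsNE_neBot (x : X) : (𝓝[≠] x).NeBot := by
  refine ⟨fun h => ?_⟩
  have h1 : ∀ᶠ _ in 𝓝[≠] x, False := by simp [h]
  have h2 := (eventually_nhdsNE_symm_iff (chartAt ℂ x) (mem_chart_source ℂ x)).2 h1
  exact h2.exists.choose_spec

/-- No point of `X` is isolated. This upgrades identities valid off isolated points, the only ones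
available for meromorphic functions, to identities at every point. -/
theorem eq_of_eventuallyEq_nhdsNE {F G : X → ℂ} {x : X} (hF : ContinuousAt F x)
    (hG : ContinuousAt G x) (h : F =ᶠ[𝓝[≠] x] G) : F x = G x := by
  have := nhdsNE_neBot x
  exact tendsto_nhds_unique_of_eventuallyEq (hF.mono_left nhdsWithin_le_nhds)
    (hG.mono_left nhdsWithin_le_nhds) h

variable {φ φ' : OpenPartialHomeomorph X ℂ} {x : X}

theorem analyticAt_comp_symm (hφ : φ ∈ IsManifold.maximalAtlas 𝓘(ℂ, ℂ) ω X) (hx : x ∈ φ.source)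
    {f : X → ℂ} (hf : ContMDiffAt 𝓘(ℂ, ℂ) 𝓘(ℂ, ℂ) ω f x) :
    AnalyticAt ℂ (fun z => f (φ.symm z)) (φ x) := by
  have h1 := contMDiffAt_symm_of_mem_maximalAtlas hφ (φ.map_source hx)
  rw [← φ.left_inv hx] at hf
  exact (contMDiffAt_iff_contDiffAt.1 (hf.comp (φ x) h1)).analyticAt

theorem contMDiffAt_comp_chart (hφ : φ ∈ IsManifold.maximalAtlas 𝓘(ℂ, ℂ) ω X)
    (hx : x ∈ φ.source) {F : ℂ → ℂ} (hF : AnalyticAt ℂ F (φ x)) :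
    ContMDiffAt 𝓘(ℂ, ℂ) 𝓘(ℂ, ℂ) ω (fun q => F (φ q)) x :=
  (contMDiffAt_iff_contDiffAt.2 hF.contDiffAt).comp x (contMDiffAt_of_mem_maximalAtlas hφ hx)

theorem analyticAt_transition (hφ : φ ∈ IsManifold.maximalAtlas 𝓘(ℂ, ℂ) ω X)
    (hφ' : φ' ∈ IsManifold.maximalAtlas 𝓘(ℂ, ℂ) ω X) (hx : x ∈ φ.source) (hx' : x ∈ φ'.source) :
    AnalyticAt ℂ (fun z => φ (φ'.symm z)) (φ' x) :=
  analyticAt_comp_symm hφ' hx' (contMDiffAt_of_mem_maximalAtlas hφ hx)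

theorem deriv_transition_ne_zero (hφ : φ ∈ IsManifold.maximalAtlas 𝓘(ℂ, ℂ) ω X)
    (hφ' : φ' ∈ IsManifold.maximalAtlas 𝓘(ℂ, ℂ) ω X) (hx : x ∈ φ.source) (hx' : x ∈ φ'.source) :
    deriv (fun z => φ (φ'.symm z)) (φ' x) ≠ 0 := by
  have h1 := (analyticAt_transition hφ hφ' hx hx').differentiableAt.hasDerivAt
  have h2 := (analyticAt_transition hφ' hφ hx' hx).differentiableAt.hasDerivAt
  have h3 : φ x = (fun z => φ (φ'.symm z)) (φ' x) := by simp [φ'.left_inv hx']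
  rw [h3] at h2
  have h4 := h2.comp (φ' x) h1
  have h5 : ((fun z => φ' (φ.symm z)) ∘ fun z => φ (φ'.symm z)) =ᶠ[𝓝 (φ' x)] id := by
    filter_upwards [eventually_symm_mem hx' (φ.open_source.mem_nhds hx),
      φ'.open_target.mem_nhds (φ'.map_source hx')] with z hz hz'
    simp [φ.left_inv hz, φ'.right_inv hz']
  -- The two coordinate changes are mutually inverse, so their derivatives multiply to `1`.
  have h6 := (h4.congr_of_eventuallyEq h5.symm).unique (hasDerivAt_id _)
  intro h0
  simp [h0] at h6

theorem meromorphicAt_symm_iff (hφ : φ ∈ IsManifold.maximalAtlas 𝓘(ℂ, ℂ) ω X)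
    (hφ' : φ' ∈ IsManifold.maximalAtlas 𝓘(ℂ, ℂ) ω X) (hx : x ∈ φ.source) (hx' : x ∈ φ'.source)
    {f : X → ℂ} : MeromorphicAt (fun z => f (φ'.symm z)) (φ' x) ↔
      MeromorphicAt (fun z => f (φ.symm z)) (φ x) := by
  rw [MeromorphicAt.meromorphicAt_congr
    ((comp_symm_eventuallyEq hx hx' f).filter_mono nhdsWithin_le_nhds),
    meromorphicAt_comp_iff_of_deriv_ne_zero (analyticAt_transition hφ hφ' hx hx')
      (deriv_transition_ne_zero hφ hφ' hx hx'), φ'.left_inv hx']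

theorem meromorphicOrderAt_symm (hφ : φ ∈ IsManifold.maximalAtlas 𝓘(ℂ, ℂ) ω X)
    (hφ' : φ' ∈ IsManifold.maximalAtlas 𝓘(ℂ, ℂ) ω X) (hx : x ∈ φ.source) (hx' : x ∈ φ'.source)
    (f : X → ℂ) : meromorphicOrderAt (fun z => f (φ'.symm z)) (φ' x) =
      meromorphicOrderAt (fun z => f (φ.symm z)) (φ x) := by
  rw [meromorphicOrderAt_congr
    ((comp_symm_eventuallyEq hx hx' f).filter_mono nhdsWithin_le_nhds),
    meromorphicOrderAt_comp_of_deriv_ne_zero (analyticAt_transition hφ hφ' hx hx')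
      (deriv_transition_ne_zero hφ hφ' hx hx'), φ'.left_inv hx']

/-! ### Linear equivalence of divisors and the Picard group -/

/-- A meromorphic function without zeros and poles agrees, away from isolated points, with
a nowhere vanishing holomorphic function. -/
theorem exists_holomorphic_eventuallyEq (hφ : φ ∈ IsManifold.maximalAtlas 𝓘(ℂ, ℂ) ω X)
    {W : Set X} (hW : W ⊆ φ.source) {f : X → ℂ}
    (hf : ∀ p ∈ W, MeromorphicAt (fun z => f (φ.symm z)) (φ p) ∧
      meromorphicOrderAt (fun z => f (φ.symm z)) (φ p) = 0) :
    ∃ F : X → ℂ, ContMDiffOn 𝓘(ℂ, ℂ) 𝓘(ℂ, ℂ) ω F W ∧ (∀ p ∈ W, F p ≠ 0) ∧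
      ∀ p ∈ W, F =ᶠ[𝓝[≠] p] f := by
  set U := φ '' W
  set f' : ℂ → ℂ := fun z => f (φ.symm z)
  have hm : MeromorphicOn f' U := by
    rintro _ ⟨p, hp, rfl⟩
    exact (hf p hp).1
  -- The normal form repairs the arbitrary values of `f` at isolated points; at order `0` it is
  -- analytic and nonzero.
  have hNF := meromorphicNFOn_toMeromorphicNFOn f' U
  have hord (p : X) (hp : p ∈ W) : meromorphicOrderAt (toMeromorphicNFOn f' U) (φ p) = 0 := by
    rw [meromorphicOrderAt_toMeromorphicNFOn hm (mem_image_of_mem φ hp)]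
    exact (hf p hp).2
  refine ⟨fun p => toMeromorphicNFOn f' U (φ p), fun p hp => ?_, fun p hp => ?_, fun p hp => ?_⟩
  · refine (contMDiffAt_comp_chart hφ (hW hp) ?_).contMDiffWithinAt
    exact (hNF (mem_image_of_mem φ hp)).meromorphicOrderAt_nonneg_iff_analyticAt.1 (hord p hp).ge
  · exact (hNF (mem_image_of_mem φ hp)).meromorphicOrderAt_eq_zero_iff.1 (hord p hp)
  · have h1 := hm.toMeromorphicNFOn_eq_self_on_nhdsNE (mem_image_of_mem φ hp)
    have h2 := (eventually_nhdsNE_iff φ (hW hp)).1 h1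
    filter_upwards [h2, nhdsWithin_le_nhds (φ.open_source.mem_nhds (hW hp))] with q hq hqs
    rw [hq]
    simp [f', φ.left_inv hqs]

theorem HasDivisor.of_mem_maximalAtlas [IsManifold 𝓘(ℂ, ℂ) ω X] {h : X → ℂ} {D : Divisor X}
    (H : HasDivisor h D) (hφ : φ ∈ IsManifold.maximalAtlas 𝓘(ℂ, ℂ) ω X) (hx : x ∈ φ.source) :
    MeromorphicAt (fun z => h (φ.symm z)) (φ x) ∧
      meromorphicOrderAt (fun z => h (φ.symm z)) (φ x) = ((D x : ℤ) : WithTop ℤ) := by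
  have hc := IsManifold.chart_mem_maximalAtlas (I := 𝓘(ℂ, ℂ)) (n := ω) x
  rw [meromorphicAt_symm_iff hc hφ (mem_chart_source ℂ x) hx,
    meromorphicOrderAt_symm hc hφ (mem_chart_source ℂ x) hx]
  exact ⟨H.1 x, H.2 x⟩

theorem Divisor.meromorphicOrderAt_localEquation (D : Divisor X) {x p : X} (hp : p ∈ D.nbhd x) :
    MeromorphicAt (fun z => D.localEquation x ((chartAt ℂ x).symm z)) (chartAt ℂ x p) ∧
      meromorphicOrderAt (fun z => D.localEquation x ((chartAt ℂ x).symm z)) (chartAt ℂ x p) =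
        ((D p : ℤ) : WithTop ℤ) := by
  set φ := chartAt ℂ x
  have h1 : (fun z => D.localEquation x (φ.symm z)) =ᶠ[𝓝[≠] φ p]
      (fun z => z - φ x) ^ D x := by
    refine Filter.EventuallyEq.filter_mono ?_ nhdsWithin_le_nhds
    filter_upwards [φ.open_target.mem_nhds (φ.map_source hp.1)] with z hz
    simp [localEquation, φ, (chartAt ℂ x).right_inv hz]
  have h2 : AnalyticAt ℂ (fun z => z - φ x) (φ p) := by fun_prop
  rw [MeromorphicAt.meromorphicAt_congr h1, meromorphicOrderAt_congr h1]
  refine ⟨h2.meromorphicAt.zpow _, ?_⟩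
  -- At the centre the order is the exponent; elsewhere on the neighbourhood the base is nonzero and
  -- `D` vanishes.
  by_cases hpx : p = x
  · subst hpx
    exact meromorphicOrderAt_zpow_id_sub_const
  · rw [D.eq_zero_of_mem_nbhd hpx hp, meromorphicOrderAt_zpow h2.meromorphicAt,
      h2.meromorphicOrderAt_eq, h2.analyticOrderAt_eq_zero.2
        (sub_ne_zero.2 fun he => hpx (φ.injOn hp.1 (mem_chart_source ℂ x) he))]
    simp

/-- Linearly equivalent divisors have the same class in the Picard group. -/
theorem HasDivisor.picClass_eq [T1Space X] [IsManifold 𝓘(ℂ, ℂ) ω X] {h : X → ℂ}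
    {D D' : Divisor X} (H : HasDivisor h (D - D')) : D.picClass = D'.picClass := by
  -- The isomorphism in local form: the order at `p` is `D p - (D' p + (D - D') p) = 0`, so the
  -- quotient is a unit up to isolated values.
  have hloc (x : X) : ∃ F : X → ℂ,
      ContMDiffOn 𝓘(ℂ, ℂ) 𝓘(ℂ, ℂ) ω F (D.nbhd x ∩ D'.nbhd x) ∧
      (∀ p ∈ D.nbhd x ∩ D'.nbhd x, F p ≠ 0) ∧ ∀ p ∈ D.nbhd x ∩ D'.nbhd x,
        F =ᶠ[𝓝[≠] p] fun q => D.localEquation x q / (D'.localEquation x q * h q) := by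
    have hc := IsManifold.chart_mem_maximalAtlas (I := 𝓘(ℂ, ℂ)) (n := ω) x
    refine exists_holomorphic_eventuallyEq hc (fun p hp => hp.1.1) fun p hp => ?_
    obtain ⟨h1, o1⟩ := D.meromorphicOrderAt_localEquation hp.1
    obtain ⟨h2, o2⟩ := D'.meromorphicOrderAt_localEquation hp.2
    obtain ⟨h3, o3⟩ := H.of_mem_maximalAtlas hc hp.1.1
    refine ⟨h1.div (h2.mul h3), ?_⟩
    have ho := meromorphicOrderAt_div h1 (h2.mul h3)
    rw [meromorphicOrderAt_mul h2 h3, o1, o2, o3] at ho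
    refine ho.trans ?_
    rw [← WithTop.coe_add, ← WithTop.LinearOrderedAddCommGroup.coe_sub]
    simp
  choose F hF hF0 hFe using hloc
  have hopen (x : X) : IsOpen (D.nbhd x ∩ D'.nbhd x) := (D.isOpen_nbhd x).inter (D'.isOpen_nbhd x)
  refine Quotient.sound ⟨fun x => D.nbhd x ∩ D'.nbhd x, F, fun x => ⟨hopen x,
    ⟨D.lineCocycle.mem_U x, D'.lineCocycle.mem_U x⟩, Subset.rfl⟩, hF, hF0, fun x y p hp => ?_⟩
  -- On the diagonal the transition functions are `1` by definition, not a quotient of local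
  -- equations, which could be `0 / 0` at `x`.
  by_cases hxy : x = y
  · subst hxy
    simp [Divisor.lineCocycle]
  have hcont {u : X → ℂ} {s : Set X} (hu : ContMDiffOn 𝓘(ℂ, ℂ) 𝓘(ℂ, ℂ) ω u s) (hs : IsOpen s)
      (hps : p ∈ s) : ContinuousAt u p := hu.continuousOn.continuousAt (hs.mem_nhds hps)
  refine eq_of_eventuallyEq_nhdsNE (F := fun q => F x q * D'.lineCocycle.g x y q)
    (G := fun q => D.lineCocycle.g x y q * F y q)
    ((hcont (hF x) (hopen x) hp.1).mul (hcont (D'.lineCocycle.holomorphic x y)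
      ((D'.isOpen_nbhd x).inter (D'.isOpen_nbhd y)) ⟨hp.1.2, hp.2.2⟩))
    ((hcont (D.lineCocycle.holomorphic x y)
      ((D.isOpen_nbhd x).inter (D.isOpen_nbhd y)) ⟨hp.1.1, hp.2.1⟩).mul
      (hcont (hF y) (hopen y) hp.2)) ?_
  filter_upwards [hFe x p hp.1, hFe y p hp.2, nhdsWithin_le_nhds ((hopen x).mem_nhds hp.1),
    nhdsWithin_le_nhds ((hopen y).mem_nhds hp.2)] with q hqx hqy hx hy
  -- Only the equation of `D'` at `x` and that of `D` at `y` get cancelled; `h` need not be nonzero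
  -- at `q`.
  have e1 := D'.localEquation_ne_zero hx.2 (D'.ne_or_eq_zero hxy hy.2)
  have e2 := D.localEquation_ne_zero hy.1 (D.ne_or_eq_zero (Ne.symm hxy) hx.1)
  simp only [Divisor.lineCocycle, if_neg hxy, hqx, hqy]
  field_simp

end Charts

/-! ### Transition matrices and sections in holomorphic frames -/

section Frames

set_option linter.unusedSectionVars false

variable {X : Type*} [TopologicalSpace X] {n : ℕ}
  {E : X → Type*} [∀ x, AddCommGroup (E x)] [∀ x, Module ℂ (E x)]
  [TopologicalSpace (TotalSpace (Fin n → ℂ) E)]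

/-- The transition matrix from the frame `e` to the frame `e'` at `p`. -/
noncomputable def transitionMatrix (e e' : Trivialization (Fin n → ℂ) (π (Fin n → ℂ) E)) (p : X) :
    Matrix (Fin n) (Fin n) ℂ :=
  Matrix.of fun i j => (e' (TotalSpace.mk p (e.symm p (Pi.single j 1)))).2 i

variable {e e' e'' : Trivialization (Fin n → ℂ) (π (Fin n → ℂ) E)} {p : X}

theorem snd_apply_symm (hp : p ∈ e.baseSet) (v : Fin n → ℂ) :
    (e (TotalSpace.mk p (e.symm p v))).2 = v := by
  rw [e.apply_mk_symm hp]

theorem transitionMatrix_unique (hp : p ∈ e.baseSet) {M : Matrix (Fin n) (Fin n) ℂ}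
    (hM : ∀ v : E p, (e' (TotalSpace.mk p v)).2 = M.mulVec (e (TotalSpace.mk p v)).2) :
    transitionMatrix e e' p = M := by
  ext i j
  simp [transitionMatrix, hM, snd_apply_symm hp]

theorem transitionMatrix_mulVec (he : e.IsLinear ℂ) (he' : e'.IsLinear ℂ) (hp : p ∈ e.baseSet)
    (hp' : p ∈ e'.baseSet) (v : E p) : (e' (TotalSpace.mk p v)).2 =
      (transitionMatrix e e' p).mulVec (e (TotalSpace.mk p v)).2 := by
  set f := e'.linearMapAt ℂ p ∘ₗ e.symmₗ ℂ p
  have hf : transitionMatrix e e' p = LinearMap.toMatrix' f := by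
    ext i j
    simp [transitionMatrix, f, LinearMap.toMatrix'_apply, hp',
      e.symmₗ_apply hp]
  rw [hf, LinearMap.toMatrix'_mulVec]
  simp [f, hp', e.symmₗ_apply hp, e.symm_apply_apply_mk hp]

theorem transitionMatrix_comp (he : e.IsLinear ℂ) (he' : e'.IsLinear ℂ) (he'' : e''.IsLinear ℂ)
    (hp : p ∈ e.baseSet) (hp' : p ∈ e'.baseSet) (hp'' : p ∈ e''.baseSet) :
    transitionMatrix e e'' p = transitionMatrix e' e'' p * transitionMatrix e e' p := by
  refine transitionMatrix_unique hp fun v => ?_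
  rw [← Matrix.mulVec_mulVec, ← transitionMatrix_mulVec he he' hp hp',
    ← transitionMatrix_mulVec he' he'' hp' hp'']

theorem transitionMatrix_self (hp : p ∈ e.baseSet) : transitionMatrix e e p = 1 :=
  transitionMatrix_unique hp fun v => by simp

theorem transitionMatrix_mul_symm (he : e.IsLinear ℂ) (he' : e'.IsLinear ℂ)
    (hp : p ∈ e.baseSet) (hp' : p ∈ e'.baseSet) :
    transitionMatrix e e' p * transitionMatrix e' e p = 1 := by
  rw [← transitionMatrix_comp he' he he' hp' hp hp', transitionMatrix_self hp']

theorem det_transitionMatrix_ne_zero (he : e.IsLinear ℂ) (he' : e'.IsLinear ℂ)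
    (hp : p ∈ e.baseSet) (hp' : p ∈ e'.baseSet) : (transitionMatrix e e' p).det ≠ 0 := fun h => by
  have := congrArg Matrix.det (transitionMatrix_mul_symm he he' hp hp')
  simp [h] at this

theorem inv_transitionMatrix (he : e.IsLinear ℂ) (he' : e'.IsLinear ℂ)
    (hp : p ∈ e.baseSet) (hp' : p ∈ e'.baseSet) :
    (transitionMatrix e' e p)⁻¹ = transitionMatrix e e' p :=
  Matrix.inv_eq_left_inv (transitionMatrix_mul_symm he he' hp hp')

variable [ChartedSpace ℂ X] [∀ x, TopologicalSpace (E x)] [FiberBundle (Fin n → ℂ) E]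
  {φ φ' : OpenPartialHomeomorph X ℂ} {A : ∀ x, E x}

section

variable [VectorBundle ℂ (Fin n → ℂ) E]

theorem isLinear_trivializationAt (x : X) : (trivializationAt (Fin n → ℂ) E x).IsLinear ℂ :=
  have : MemTrivializationAtlas (trivializationAt (Fin n → ℂ) E x) :=
    ⟨trivialization_mem_atlas (Fin n → ℂ) E x⟩
  VectorBundle.trivialization_linear' _

/-- The transition matrices between holomorphic frames are holomorphic. -/
theorem IsHolomorphicFrame.analyticAt_transitionMatrix (he : IsHolomorphicFrame e)
    (he' : IsHolomorphicFrame e') (hφ : φ ∈ IsManifold.maximalAtlas 𝓘(ℂ, ℂ) ω X)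
    (hx : p ∈ φ.source) (hp : p ∈ e.baseSet) (hp' : p ∈ e'.baseSet) (i j : Fin n) :
    AnalyticAt ℂ (fun z => transitionMatrix e e' (φ.symm z) i j) (φ p) := by
  set t := trivializationAt (Fin n → ℂ) E p
  have ht : t.IsLinear ℂ := isLinear_trivializationAt p
  have hpt : p ∈ t.baseSet := mem_baseSet_trivializationAt (Fin n → ℂ) E p
  -- Holomorphic frames are compared by definition only with the bundle atlas, so the transition
  -- from `e` to `e'` is factored through `t`.
  have key {f : Trivialization (Fin n → ℂ) (π (Fin n → ℂ) E)} (hf : IsHolomorphicFrame f)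
      (hpf : p ∈ f.baseSet) (i j : Fin n) :
      AnalyticAt ℂ (fun z => transitionMatrix f t (φ.symm z) i j) (φ p) := by
    obtain ⟨g, hg, hgt⟩ := hf.holomorphic t (trivialization_mem_atlas (Fin n → ℂ) E p)
    have hs : f.baseSet ∩ t.baseSet ∈ 𝓝 p :=
      (f.open_baseSet.inter t.open_baseSet).mem_nhds ⟨hpf, hpt⟩
    refine (analyticAt_comp_symm hφ hx ((hg i j).contMDiffAt hs)).congr ?_
    filter_upwards [eventually_symm_mem hx hs] with z hz
    rw [transitionMatrix_unique hz.1 (hgt _ hz)]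
  have hs : e.baseSet ∩ e'.baseSet ∩ t.baseSet ∈ 𝓝 p :=
    ((e.open_baseSet.inter e'.open_baseSet).inter t.open_baseSet).mem_nhds ⟨⟨hp, hp'⟩, hpt⟩
  have hinv := analyticAt_inv_matrix (key he' hp') (by
    rw [φ.left_inv hx]
    exact det_transitionMatrix_ne_zero he'.linear ht hp' hpt)
  have hprod : AnalyticAt ℂ (fun z => ∑ k, (transitionMatrix e' t (φ.symm z))⁻¹ i k *
      transitionMatrix e t (φ.symm z) k j) (φ p) :=
    Finset.analyticAt_fun_sum _ fun k _ => (hinv i k).mul (key he hp k j)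
  refine hprod.congr ?_
  filter_upwards [eventually_symm_mem hx hs] with z hz
  rw [transitionMatrix_comp he.linear ht he'.linear hz.1.1 hz.2 hz.1.2, Matrix.mul_apply,
    inv_transitionMatrix ht he'.linear hz.2 hz.1.2]

theorem IsHolomorphicFrame.analyticAt_det_transitionMatrix (he : IsHolomorphicFrame e)
    (he' : IsHolomorphicFrame e') (hφ : φ ∈ IsManifold.maximalAtlas 𝓘(ℂ, ℂ) ω X)
    (hx : p ∈ φ.source) (hp : p ∈ e.baseSet) (hp' : p ∈ e'.baseSet) :
    AnalyticAt ℂ (fun z => (transitionMatrix e e' (φ.symm z)).det) (φ p) :=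
  analyticAt_det fun i j => he.analyticAt_transitionMatrix he' hφ hx hp hp' i j

end

theorem localRep_transition (he : e.IsLinear ℂ) (he' : e'.IsLinear ℂ) (hx : p ∈ φ.source)
    (hx' : p ∈ φ'.source) (hp : p ∈ e.baseSet) (hp' : p ∈ e'.baseSet) (A : ∀ x, E x) :
    ∀ᶠ z in 𝓝 (φ' p), localRep e' φ' A z =
      (transitionMatrix e e' (φ'.symm z)).mulVec (localRep e φ A (φ (φ'.symm z))) := by
  filter_upwards [eventually_symm_mem hx' (φ.open_source.mem_nhds hx),
    eventually_symm_mem hx' (e.open_baseSet.mem_nhds hp),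
    eventually_symm_mem hx' (e'.open_baseSet.mem_nhds hp')] with z h1 h2 h3
  simp only [localRep]
  rw [φ.left_inv h1]
  exact transitionMatrix_mulVec he he' h2 h3 _

/-- The components of the section `A` in the frame `e` and the coordinate `φ` are holomorphic
at `p`. -/
def IsRegularAt (e : Trivialization (Fin n → ℂ) (π (Fin n → ℂ) E)) (φ : OpenPartialHomeomorph X ℂ)
    (A : ∀ x, E x) (p : X) : Prop :=
  ∀ j, AnalyticAt ℂ (fun z => localRep e φ A z j) (φ p)

variable [VectorBundle ℂ (Fin n → ℂ) E]

theorem IsRegularAt.transition (hA : IsRegularAt e φ A p) (he : IsHolomorphicFrame e)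
    (he' : IsHolomorphicFrame e') (hφ : φ ∈ IsManifold.maximalAtlas 𝓘(ℂ, ℂ) ω X)
    (hφ' : φ' ∈ IsManifold.maximalAtlas 𝓘(ℂ, ℂ) ω X) (hx : p ∈ φ.source)
    (hx' : p ∈ φ'.source) (hp : p ∈ e.baseSet) (hp' : p ∈ e'.baseSet) :
    IsRegularAt e' φ' A p := fun j => by
  have hψ := analyticAt_transition hφ hφ' hx hx'
  have h : AnalyticAt ℂ (fun z => ∑ k, transitionMatrix e e' (φ'.symm z) j k *
      localRep e φ A (φ (φ'.symm z)) k) (φ' p) :=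
    Finset.analyticAt_fun_sum _ fun k _ =>
      (he.analyticAt_transitionMatrix he' hφ' hx' hp hp' j k).mul
        (AnalyticAt.fun_comp (by rw [φ'.left_inv hx']; exact hA k) hψ)
  refine h.congr ?_
  filter_upwards [localRep_transition he.linear he'.linear hx hx' hp hp' A] with z hz
  rw [hz]
  rfl

variable [IsManifold 𝓘(ℂ, ℂ) ω X] [ContMDiffVectorBundle ω (Fin n → ℂ) E 𝓘(ℂ, ℂ)]

theorem isHolomorphicFrame_trivializationAt (x : X) :
    IsHolomorphicFrame (trivializationAt (Fin n → ℂ) E x) where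
  linear := isLinear_trivializationAt x
  holomorphic e' he' := by
    set t := trivializationAt (Fin n → ℂ) E x
    have : MemTrivializationAtlas t := ⟨trivialization_mem_atlas (Fin n → ℂ) E x⟩
    have : MemTrivializationAtlas e' := ⟨he'⟩
    have hl : e'.IsLinear ℂ := VectorBundle.trivialization_linear' _
    refine ⟨transitionMatrix t e', fun i j => ?_, fun p hp v =>
      transitionMatrix_mulVec (isLinear_trivializationAt x) hl hp.1 hp.2 v⟩
    have h := contMDiffOn_coordChangeL (n := ω) (IB := 𝓘(ℂ, ℂ)) t e'
    -- The bundle gives a holomorphic operator-valued map; the matrix entry is a continuous linear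
    -- functional of it.
    let L : ((Fin n → ℂ) →L[ℂ] (Fin n → ℂ)) →L[ℂ] ℂ :=
      (ContinuousLinearMap.proj (R := ℂ) (φ := fun _ : Fin n => ℂ) i).comp
        (ContinuousLinearMap.apply ℂ (Fin n → ℂ) (Pi.single j 1))
    refine (L.contMDiff.comp_contMDiffOn h).congr fun p hp => ?_
    simp [L, transitionMatrix, Trivialization.coordChangeL_apply _ _ hp]

theorem meromorphicAt_apply {f : ℂ → Fin n → ℂ} {z : ℂ} (hf : MeromorphicAt f z) (j : Fin n) :
    MeromorphicAt (fun w => f w j) z := by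
  obtain ⟨m, hm⟩ := hf
  exact ⟨m, (analyticAt_pi_iff.1 hm j :)⟩

/-- The definition tests one preferred trivialization and chart per point; the holomorphic
transition matrix carries the property to all others. -/
theorem IsMeromorphicSection.meromorphicAt (hA : IsMeromorphicSection (n := n) A)
    (he : IsHolomorphicFrame e) (hφ : φ ∈ IsManifold.maximalAtlas 𝓘(ℂ, ℂ) ω X)
    (hx : p ∈ φ.source) (hp : p ∈ e.baseSet) (j : Fin n) :
    MeromorphicAt (fun z => localRep e φ A z j) (φ p) := by
  set t := trivializationAt (Fin n → ℂ) E p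
  have ht : IsHolomorphicFrame t := isHolomorphicFrame_trivializationAt p
  have hpt : p ∈ t.baseSet := mem_baseSet_trivializationAt (Fin n → ℂ) E p
  have hc := IsManifold.chart_mem_maximalAtlas (I := 𝓘(ℂ, ℂ)) (n := ω) p
  have hs := mem_chart_source ℂ p
  have h : MeromorphicAt (fun z => ∑ k, transitionMatrix t e (φ.symm z) j k *
      localRep t (chartAt ℂ p) A (chartAt ℂ p (φ.symm z)) k) (φ p) := by
    refine MeromorphicAt.fun_sum fun k _ =>
      (ht.analyticAt_transitionMatrix he hφ hx hpt hp j k).meromorphicAt.mul ?_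
    refine MeromorphicAt.comp_analyticAt (f := fun z => localRep t (chartAt ℂ p) A z k) ?_
      (analyticAt_transition hc hφ hs hx)
    rw [φ.left_inv hx]
    exact meromorphicAt_apply (hA p) k
  refine h.congr (Filter.EventuallyEq.filter_mono ?_ nhdsWithin_le_nhds)
  filter_upwards [localRep_transition ht.linear he.linear hs hx hpt hp A] with z hz
  rw [hz]
  rfl

theorem IsMeromorphicSection.eventually_isRegularAt (hA : IsMeromorphicSection (n := n) A)
    (he : IsHolomorphicFrame e) (hφ : φ ∈ IsManifold.maximalAtlas 𝓘(ℂ, ℂ) ω X)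
    (hx : p ∈ φ.source) (hp : p ∈ e.baseSet) : ∀ᶠ q in 𝓝[≠] p, IsRegularAt e φ A q :=
  (eventually_nhdsNE_iff φ hx).1
    (eventually_all.2 fun j => (hA.meromorphicAt he hφ hx hp j).eventually_analyticAt)

theorem IsMeromorphicSection.meromorphicAt_localWronskian (hA : IsMeromorphicSection (n := n) A)
    (he : IsHolomorphicFrame e) (hφ : φ ∈ IsManifold.maximalAtlas 𝓘(ℂ, ℂ) ω X)
    (hx : p ∈ φ.source) (hp : p ∈ e.baseSet) : MeromorphicAt (localWronskian e φ A) (φ p) :=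
  meromorphicAt_det_wronskianMatrix (hA.meromorphicAt he hφ hx hp)

/-- The transition functions between projectively flat frames are locally a function times
a constant matrix. -/
theorem ProjFlatStructure.IsFrame.exists_transitionMatrix_eq {P : ProjFlatStructure n E}
    (he : P.IsFrame e) (he' : P.IsFrame e') (hp : p ∈ e.baseSet) (hp' : p ∈ e'.baseSet) :
    ∃ (c : X → ℂ) (T : Matrix (Fin n) (Fin n) ℂ), ContMDiffAt 𝓘(ℂ, ℂ) 𝓘(ℂ, ℂ) ω c p ∧
      ∀ᶠ q in 𝓝 p, transitionMatrix e e' q = c q • T := by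
  obtain ⟨t, ht, hpt⟩ := P.cover p
  obtain ⟨s, hs, hso, hps, c, T, hc, hc0, hT⟩ := he.transition t ht p ⟨hp, hpt⟩
  obtain ⟨s', hs', hso', hps', c', T', hc', hc0', hT'⟩ := he'.transition t ht p ⟨hp', hpt⟩
  -- The transitions to `t` are `c • T` from `e` and `c' • T'` from `e'`; the second is inverted and
  -- composed with the first.
  refine ⟨fun q => c q / c' q, (T'⁻¹ * T : GL (Fin n) ℂ),
    (hc.contMDiffAt (hso.mem_nhds hps)).div₀ (hc'.contMDiffAt (hso'.mem_nhds hps')) (hc0' p hps'),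
    ?_⟩
  filter_upwards [hso.mem_nhds hps, hso'.mem_nhds hps'] with q hq hq'
  refine transitionMatrix_unique (hs hq).1 fun v => ?_
  have h1 := (hT' q hq' v).symm.trans (hT q hq v)
  have h2 := congrArg (fun u => (c' q)⁻¹ • ((T'⁻¹ : GL (Fin n) ℂ) : Matrix (Fin n) (Fin n) ℂ).mulVec u)
    h1
  simp only [Matrix.mulVec_smul, Matrix.mulVec_mulVec, smul_smul, inv_mul_cancel₀ (hc0' q hq'),
    ← Units.val_mul, inv_mul_cancel, one_smul, Units.val_one, Matrix.one_mulVec] at h2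
  rw [h2, Matrix.smul_mulVec, div_eq_inv_mul]

variable (n) in
/-- The factor by which the Wronskian determinant changes under the change of coordinates
from `φ` to `φ'`. -/
noncomputable def jacobianFactor (φ φ' : OpenPartialHomeomorph X ℂ) (p : X) : ℂ :=
  ∏ i : Fin n, deriv (fun z => φ (φ'.symm z)) (φ' p) ^ (i : ℕ)

theorem jacobianFactor_ne_zero (hφ : φ ∈ IsManifold.maximalAtlas 𝓘(ℂ, ℂ) ω X)
    (hφ' : φ' ∈ IsManifold.maximalAtlas 𝓘(ℂ, ℂ) ω X) (hx : p ∈ φ.source)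
    (hx' : p ∈ φ'.source) : jacobianFactor n φ φ' p ≠ 0 :=
  Finset.prod_ne_zero_iff.2 fun _ _ => pow_ne_zero _ (deriv_transition_ne_zero hφ hφ' hx hx')

theorem analyticAt_jacobianFactor (hφ : φ ∈ IsManifold.maximalAtlas 𝓘(ℂ, ℂ) ω X)
    (hφ' : φ' ∈ IsManifold.maximalAtlas 𝓘(ℂ, ℂ) ω X) (hx : p ∈ φ.source)
    (hx' : p ∈ φ'.source) :
    AnalyticAt ℂ (fun z => jacobianFactor n φ φ' (φ'.symm z)) (φ' p) := by
  have h : AnalyticAt ℂ (fun z => ∏ i : Fin n, deriv (fun z => φ (φ'.symm z)) z ^ (i : ℕ)) (φ' p) :=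
    Finset.analyticAt_fun_prod _ fun i _ => (analyticAt_transition hφ hφ' hx hx').deriv.pow _
  refine h.congr ?_
  filter_upwards [φ'.open_target.mem_nhds (φ'.map_source hx')] with z hz
  rw [jacobianFactor, φ'.right_inv hz]

/-- The transformation rule of the Wronskian determinant of a section. -/
theorem ProjFlatStructure.IsFrame.localWronskian_transition {P : ProjFlatStructure n E}
    (he : P.IsFrame e) (he' : P.IsFrame e') (hφ : φ ∈ IsManifold.maximalAtlas 𝓘(ℂ, ℂ) ω X)
    (hφ' : φ' ∈ IsManifold.maximalAtlas 𝓘(ℂ, ℂ) ω X) (hx : p ∈ φ.source)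
    (hx' : p ∈ φ'.source) (hp : p ∈ e.baseSet) (hp' : p ∈ e'.baseSet)
    (hA : IsRegularAt e φ A p) : localWronskian e' φ' A (φ' p) =
      (transitionMatrix e e' p).det * jacobianFactor n φ φ' p * localWronskian e φ A (φ p) := by
  obtain ⟨c, T, hc, hT⟩ := he.exists_transitionMatrix_eq he' hp hp'
  have hab : ∀ᶠ z in 𝓝 (φ' p), localRep e' φ' A z =
      c (φ'.symm z) • T.mulVec (localRep e φ A (φ (φ'.symm z))) := by
    filter_upwards [localRep_transition he.isHolomorphicFrame.linear he'.isHolomorphicFrame.linear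
      hx hx' hp hp' A, eventually_symm_mem hx' hT] with z h1 h2
    rw [h1, show transitionMatrix e e' (φ'.symm z) = c (φ'.symm z) • T from h2, Matrix.smul_mulVec]
  have h := det_wronskianMatrix_transition (a := localRep e φ A) (c := fun z => c (φ'.symm z)) T
    (analyticAt_comp_symm hφ' hx' hc) (analyticAt_transition hφ hφ' hx hx')
    (by simp only [φ'.left_inv hx']; exact hA) hab
  simp only [φ'.left_inv hx'] at h
  rw [hT.self_of_nhds]
  exact h

/-- The transition factor is a holomorphic unit, and composition with a biholomorphic coordinate
change preserves orders. -/
theorem ProjFlatStructure.IsFrame.meromorphicOrderAt_localWronskian {P : ProjFlatStructure n E}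
    (he : P.IsFrame e) (he' : P.IsFrame e') (hφ : φ ∈ IsManifold.maximalAtlas 𝓘(ℂ, ℂ) ω X)
    (hφ' : φ' ∈ IsManifold.maximalAtlas 𝓘(ℂ, ℂ) ω X) (hx : p ∈ φ.source)
    (hx' : p ∈ φ'.source) (hp : p ∈ e.baseSet) (hp' : p ∈ e'.baseSet)
    (hA : IsMeromorphicSection (n := n) A) :
    meromorphicOrderAt (localWronskian e' φ' A) (φ' p) =
      meromorphicOrderAt (localWronskian e φ A) (φ p) := by
  have hs : e.baseSet ∩ e'.baseSet ∩ (φ.source ∩ φ'.source) ∈ 𝓝 p :=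
    ((e.open_baseSet.inter e'.open_baseSet).inter
      (φ.open_source.inter φ'.open_source)).mem_nhds ⟨⟨hp, hp'⟩, hx, hx'⟩
  have hψ := analyticAt_transition hφ hφ' hx hx'
  set u : ℂ → ℂ := fun z =>
    (transitionMatrix e e' (φ'.symm z)).det * jacobianFactor n φ φ' (φ'.symm z)
  have hu : AnalyticAt ℂ u (φ' p) :=
    (he.isHolomorphicFrame.analyticAt_det_transitionMatrix he'.isHolomorphicFrame hφ' hx' hp
      hp').mul (analyticAt_jacobianFactor hφ hφ' hx hx')
  have hu0 : u (φ' p) ≠ 0 := by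
    simp only [u, φ'.left_inv hx']
    exact mul_ne_zero (det_transitionMatrix_ne_zero he.isHolomorphicFrame.linear
      he'.isHolomorphicFrame.linear hp hp') (jacobianFactor_ne_zero hφ hφ' hx hx')
  -- The transformation rule requires regular components, and `A` may have a pole at `p` itself.
  have h : localWronskian e' φ' A =ᶠ[𝓝[≠] φ' p]
      u * (localWronskian e φ A ∘ fun z => φ (φ'.symm z)) := by
    refine (eventually_nhdsNE_iff φ' hx').2 ?_
    filter_upwards [hA.eventually_isRegularAt he.isHolomorphicFrame hφ hx hp,
      nhdsWithin_le_nhds hs] with q hq hqs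
    rw [he.localWronskian_transition he' hφ hφ' hqs.2.1 hqs.2.2 hqs.1.1 hqs.1.2 hq]
    simp [u, φ'.left_inv hqs.2.2]
  rw [meromorphicOrderAt_congr h, meromorphicOrderAt_mul_of_ne_zero hu hu0,
    meromorphicOrderAt_comp_of_deriv_ne_zero hψ (deriv_transition_ne_zero hφ hφ' hx hx'),
    φ'.left_inv hx']

end Frames

/-! ### The Wronskian divisor and the quotient of two Wronskians -/

namespace ProjFlatStructure

set_option linter.unusedSectionVars false

variable {X : Type*} [TopologicalSpace X] [ChartedSpace ℂ X] {n : ℕ}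
  {E : X → Type*} [∀ x, AddCommGroup (E x)] [∀ x, Module ℂ (E x)] [∀ x, TopologicalSpace (E x)]
  [TopologicalSpace (TotalSpace (Fin n → ℂ) E)] [FiberBundle (Fin n → ℂ) E]
  (P Q : ProjFlatStructure n E) {A B : ∀ x, E x} {p : X}

/-- A projectively flat frame around `p`. -/
noncomputable def frameAt (p : X) : Trivialization (Fin n → ℂ) (π (Fin n → ℂ) E) :=
  (P.cover p).choose

theorem isFrame_frameAt (p : X) : P.IsFrame (P.frameAt p) :=
  P.isFrame_of_mem (P.cover p).choose_spec.1

theorem mem_baseSet_frameAt (p : X) : p ∈ (P.frameAt p).baseSet :=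
  (P.cover p).choose_spec.2

/-- The order at `p` of the local Wronskian determinants of `A`. -/
noncomputable def wronskianOrder (A : ∀ x, E x) (p : X) : WithTop ℤ :=
  meromorphicOrderAt (localWronskian (P.frameAt p) (chartAt ℂ p) A) (chartAt ℂ p p)

/-- The value at `p` of the Wronskian determinant of `A` as a local section of `det E ⊗ K ^ m`
with `m = n (n - 1) / 2`, in the bundle trivialization and the chart at `p`. -/
noncomputable def normalizedWronskian (A : ∀ x, E x) (p : X) : ℂ :=
  (transitionMatrix (P.frameAt p) (trivializationAt (Fin n → ℂ) E p) p).det *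
    localWronskian (P.frameAt p) (chartAt ℂ p) A (chartAt ℂ p p)

/-- The quotient of the Wronskian determinants of `A` and `B`. -/
noncomputable def wronskianQuotient (A B : ∀ x, E x) (p : X) : ℂ :=
  P.normalizedWronskian A p / Q.normalizedWronskian B p

variable [IsManifold 𝓘(ℂ, ℂ) ω X] [VectorBundle ℂ (Fin n → ℂ) E]
  [ContMDiffVectorBundle ω (Fin n → ℂ) E 𝓘(ℂ, ℂ)]
  {P Q} {e e' : Trivialization (Fin n → ℂ) (π (Fin n → ℂ) E)} {φ : OpenPartialHomeomorph X ℂ}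

theorem IsFrame.wronskianOrder_eq (he : P.IsFrame e)
    (hφ : φ ∈ IsManifold.maximalAtlas 𝓘(ℂ, ℂ) ω X) (hp : p ∈ e.baseSet) (hx : p ∈ φ.source)
    (hA : IsMeromorphicSection (n := n) A) :
    P.wronskianOrder A p = meromorphicOrderAt (localWronskian e φ A) (φ p) :=
  he.meromorphicOrderAt_localWronskian (P.isFrame_frameAt p) hφ
    (IsManifold.chart_mem_maximalAtlas p) hx (mem_chart_source ℂ p) hp (P.mem_baseSet_frameAt p) hA

theorem eventually_wronskianOrder_eq_zero (hA : IsMeromorphicSection (n := n) A)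
    (h : P.wronskianOrder A p ≠ ⊤) : ∀ᶠ q in 𝓝[≠] p, P.wronskianOrder A q = 0 := by
  have he := P.isFrame_frameAt p
  have hp := P.mem_baseSet_frameAt p
  have hφ := IsManifold.chart_mem_maximalAtlas (I := 𝓘(ℂ, ℂ)) (n := ω) p
  have hx := mem_chart_source ℂ p
  filter_upwards [(eventually_nhdsNE_iff _ hx).1 (eventually_meromorphicOrderAt_eq_zero
      (hA.meromorphicAt_localWronskian he.isHolomorphicFrame hφ hx hp) h),
    nhdsWithin_le_nhds ((P.frameAt p).open_baseSet.mem_nhds hp),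
    nhdsWithin_le_nhds ((chartAt ℂ p).open_source.mem_nhds hx)] with q hq h1 h2
  rw [he.wronskianOrder_eq hφ h1 h2 hA, hq]

theorem eventually_wronskianOrder_eq_top (hA : IsMeromorphicSection (n := n) A)
    (h : P.wronskianOrder A p = ⊤) : ∀ᶠ q in 𝓝 p, P.wronskianOrder A q = ⊤ := by
  have he := P.isFrame_frameAt p
  have hp := P.mem_baseSet_frameAt p
  have hφ := IsManifold.chart_mem_maximalAtlas (I := 𝓘(ℂ, ℂ)) (n := ω) p
  have hx := mem_chart_source ℂ p
  have h0 := eventually_eventually_nhds.2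
    (eventually_nhdsWithin_iff.1 (meromorphicOrderAt_eq_top_iff.1 h))
  have h1 := ((chartAt ℂ p).eventually_nhds _ hx).1 h0
  filter_upwards [h1, (P.frameAt p).open_baseSet.mem_nhds hp,
    (chartAt ℂ p).open_source.mem_nhds hx] with q hq hqe hqs
  by_cases hqp : q = p
  · rw [hqp, h]
  rw [he.wronskianOrder_eq hφ hqe hqs hA, meromorphicOrderAt_eq_top_iff]
  -- The Wronskian is known to vanish only off `p`, so the neighbourhood of `q` is shrunk to avoid
  -- `p`.
  have hne : chartAt ℂ p q ≠ chartAt ℂ p p := fun h' => hqp ((chartAt ℂ p).injOn hqs hx h')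
  filter_upwards [nhdsWithin_le_nhds hq, nhdsWithin_le_nhds (isOpen_ne.mem_nhds hne)]
    with z hz hzne
  exact hz hzne

/-- Identity theorem: finite order and infinite order are both open conditions, and `X` is
connected. -/
theorem IsGeneric.wronskianOrder_ne_top [ConnectedSpace X] (hA : P.IsGeneric A) (p : X) :
    P.wronskianOrder A p ≠ ⊤ := by
  obtain ⟨hA, e, he, φ, hφ, x, hx, h⟩ := hA
  rw [← he.wronskianOrder_eq hφ hx.1 hx.2 hA] at h
  have hclopen : IsClopen {q | P.wronskianOrder A q ≠ ⊤} := by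
    refine ⟨⟨isOpen_iff_mem_nhds.2 fun q hq => ?_⟩, isOpen_iff_mem_nhds.2 fun q hq => ?_⟩
    · filter_upwards [eventually_wronskianOrder_eq_top hA (not_not.1 hq)] with r hr
      exact not_not.2 hr
    · filter_upwards [eventually_nhdsWithin_iff.1 (eventually_wronskianOrder_eq_zero hA hq)]
        with r hr
      by_cases hrq : r = q
      · rwa [hrq]
      · exact (hr hrq).trans_ne WithTop.zero_ne_top
  have := hclopen.eq_univ ⟨x, h⟩
  exact (this ▸ mem_univ p : p ∈ {q | P.wronskianOrder A q ≠ ⊤})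

theorem IsGeneric.existsUnique_isWronskianDivisor [ConnectedSpace X] (hA : P.IsGeneric A) :
    ∃! D : Divisor X, P.IsWronskianDivisor A D := by
  have hcoe (q : X) : (((P.wronskianOrder A q).untopD 0 : ℤ) : WithTop ℤ) =
      P.wronskianOrder A q := by
    obtain ⟨m, hm⟩ := WithTop.ne_top_iff_exists.1 (hA.wronskianOrder_ne_top q)
    rw [← hm]
    rfl
  -- The default `0` is never used, by `hcoe`. Local finiteness holds because the order is `0` on a
  -- punctured neighbourhood of each point.
  refine ⟨⟨fun q => (P.wronskianOrder A q).untopD 0, subset_univ _, fun q _ => ?_⟩,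
    fun e he φ hφ x hx => ⟨hA.1.meromorphicAt_localWronskian he.isHolomorphicFrame hφ hx.2 hx.1,
      ?_⟩, fun D hD => ?_⟩
  · refine ⟨_, eventually_nhdsWithin_iff.1
      (eventually_wronskianOrder_eq_zero hA.1 (hA.wronskianOrder_ne_top q)),
      (finite_singleton q).subset fun r hr => ?_⟩
    by_contra hrq
    exact hr.2 (by simp [hr.1 hrq])
  · exact (he.wronskianOrder_eq hφ hx.1 hx.2 hA.1).symm.trans (hcoe x).symm
  · ext q
    have h := (hD _ (P.isFrame_frameAt q) _ (IsManifold.chart_mem_maximalAtlas q) q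
      ⟨P.mem_baseSet_frameAt q, mem_chart_source ℂ q⟩).2
    exact WithTop.coe_injective (h.symm.trans (hcoe q).symm)

/-- The chosen frame at `p` drops out by multiplicativity of transition determinants, so a single
frame and coordinate can serve all regular points near a given one. -/
theorem IsFrame.normalizedWronskian_eq (he : P.IsFrame e)
    (hφ : φ ∈ IsManifold.maximalAtlas 𝓘(ℂ, ℂ) ω X) (hp : p ∈ e.baseSet) (hx : p ∈ φ.source)
    (hA : IsRegularAt e φ A p) : P.normalizedWronskian A p =
      (transitionMatrix e (trivializationAt (Fin n → ℂ) E p) p).det *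
        jacobianFactor n φ (chartAt ℂ p) p * localWronskian e φ A (φ p) := by
  have he' := P.isFrame_frameAt p
  have hp' := P.mem_baseSet_frameAt p
  rw [normalizedWronskian, he.localWronskian_transition he' hφ
    (IsManifold.chart_mem_maximalAtlas p) hx (mem_chart_source ℂ p) hp hp' hA,
    transitionMatrix_comp he.isHolomorphicFrame.linear he'.isHolomorphicFrame.linear
      (isLinear_trivializationAt p) hp hp' (mem_baseSet_trivializationAt _ E p), Matrix.det_mul]
  ring

/-- The reference trivialization and chart jump with the point, but contribute the same factor to
numerator and denominator. What survives is the change between the two frames, which may belong to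
different structures. -/
theorem IsFrame.eventually_wronskianQuotient_eq (he : P.IsFrame e) (he' : Q.IsFrame e')
    (hφ : φ ∈ IsManifold.maximalAtlas 𝓘(ℂ, ℂ) ω X) (hp : p ∈ e.baseSet) (hp' : p ∈ e'.baseSet)
    (hx : p ∈ φ.source) (hA : IsMeromorphicSection (n := n) A)
    (hB : IsMeromorphicSection (n := n) B) :
    ∀ᶠ z in 𝓝[≠] φ p, wronskianQuotient P Q A B (φ.symm z) =
      (transitionMatrix e e' (φ.symm z)).det *
        (localWronskian e φ A z / localWronskian e' φ B z) := by
  refine (eventually_nhdsNE_iff φ hx).2 ?_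
  filter_upwards [hA.eventually_isRegularAt he.isHolomorphicFrame hφ hx hp,
    hB.eventually_isRegularAt he'.isHolomorphicFrame hφ hx hp',
    nhdsWithin_le_nhds (e.open_baseSet.mem_nhds hp),
    nhdsWithin_le_nhds (e'.open_baseSet.mem_nhds hp'),
    nhdsWithin_le_nhds (φ.open_source.mem_nhds hx)] with q hqA hqB hq hq' hqx
  have ht := isLinear_trivializationAt (n := n) (E := E) q
  have hqt := mem_baseSet_trivializationAt (Fin n → ℂ) E q
  have h1 := det_transitionMatrix_ne_zero he'.isHolomorphicFrame.linear ht hq' hqt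
  have h2 := jacobianFactor_ne_zero (n := n) hφ
    (IsManifold.chart_mem_maximalAtlas (I := 𝓘(ℂ, ℂ)) (n := ω) q) hqx (mem_chart_source ℂ q)
  rw [φ.left_inv hqx, wronskianQuotient, he.normalizedWronskian_eq hφ hq hqx hqA,
    he'.normalizedWronskian_eq hφ hq' hqx hqB, transitionMatrix_comp he.isHolomorphicFrame.linear
      he'.isHolomorphicFrame.linear ht hq hq' hqt, Matrix.det_mul, mul_div_mul_comm]
  -- The Wronskian of `B` is left uncancelled, so its zeros do no harm.
  congr 1
  field_simp

theorem hasDivisor_wronskianQuotient (hA : IsMeromorphicSection (n := n) A)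
    (hB : IsMeromorphicSection (n := n) B) {DA DB : Divisor X} (hDA : P.IsWronskianDivisor A DA)
    (hDB : Q.IsWronskianDivisor B DB) : HasDivisor (wronskianQuotient P Q A B) (DA - DB) := by
  suffices h : ∀ x, MeromorphicAt
      (fun z => wronskianQuotient P Q A B ((chartAt ℂ x).symm z)) (chartAt ℂ x x) ∧
      meromorphicOrder (wronskianQuotient P Q A B) x = (((DA - DB) x : ℤ) : WithTop ℤ) from
    ⟨fun x => (h x).1, fun x => (h x).2⟩
  intro x
  have hφ := IsManifold.chart_mem_maximalAtlas (I := 𝓘(ℂ, ℂ)) (n := ω) x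
  have hx := mem_chart_source ℂ x
  have he := P.isFrame_frameAt x
  have he' := Q.isFrame_frameAt x
  have hp := P.mem_baseSet_frameAt x
  have hp' := Q.mem_baseSet_frameAt x
  obtain ⟨mA, oA⟩ := hDA _ he _ hφ x ⟨hp, hx⟩
  obtain ⟨mB, oB⟩ := hDB _ he' _ hφ x ⟨hp', hx⟩
  have h := he.eventually_wronskianQuotient_eq he' hφ hp hp' hx hA hB
  have hu := he.isHolomorphicFrame.analyticAt_det_transitionMatrix he'.isHolomorphicFrame hφ hx hp
    hp'
  have hu0 := det_transitionMatrix_ne_zero he.isHolomorphicFrame.linear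
    he'.isHolomorphicFrame.linear hp hp'
  refine ⟨(hu.meromorphicAt.mul (mA.div mB)).congr (EventuallyEq.symm h), ?_⟩
  refine (meromorphicOrderAt_congr h).trans ?_
  refine (meromorphicOrderAt_mul_of_ne_zero hu (by rwa [(chartAt ℂ x).left_inv hx])).trans ?_
  refine (meromorphicOrderAt_div mA mB).trans ?_
  rw [oA, oB, ← WithTop.LinearOrderedAddCommGroup.coe_sub]
  rfl

end ProjFlatStructure

/-- Valid also at zeros of `w(B)`: there both the determinant of the matrix inverse and the scalar
inverse are `0` by convention. -/
theorem det_localQuotient {X : Type*} [TopologicalSpace X] {n : ℕ} {E : X → Type*}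
    [TopologicalSpace (TotalSpace (Fin n → ℂ) E)]
    (e : Trivialization (Fin n → ℂ) (π (Fin n → ℂ) E)) (φ : OpenPartialHomeomorph X ℂ)
    (A B : ∀ x, E x) (z : ℂ) :
    (localQuotient e φ A B z).det = localWronskian e φ A z / localWronskian e φ B z := by
  rw [localQuotient, Matrix.det_mul, Matrix.det_nonsing_inv, Ring.inverse_eq_inv',
    div_eq_inv_mul]
  rfl

end PFWronskian

theorem mainTheorem1 {X : Type*} [TopologicalSpace X] [T2Space X] [ConnectedSpace X]
    [ChartedSpace ℂ X] [IsManifold 𝓘(ℂ, ℂ) ω X] (n : ℕ)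
    (E : X → Type*) [∀ x, AddCommGroup (E x)] [∀ x, Module ℂ (E x)]
    [∀ x, TopologicalSpace (E x)] [TopologicalSpace (TotalSpace (Fin n → ℂ) E)]
    [FiberBundle (Fin n → ℂ) E] [VectorBundle ℂ (Fin n → ℂ) E]
    [ContMDiffVectorBundle ω (Fin n → ℂ) E 𝓘(ℂ, ℂ)]
    (P : ProjFlatStructure n E) :
    -- the divisor of the local Wronskian determinant is globally well defined
    (∀ A : (∀ x, E x), P.IsGeneric A → ∃! D : Divisor X, P.IsWronskianDivisor A D) ∧
    -- `w(A) / w(B) = det (A / B)` is a global meromorphic function with divisor `div A - div B`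
    (∀ A B : (∀ x, E x), P.IsGeneric A → P.IsGeneric B →
      ∀ DA DB : Divisor X, P.IsWronskianDivisor A DA → P.IsWronskianDivisor B DB →
      ∃ h : X → ℂ, HasDivisor h (DA - DB) ∧
        ∀ e, P.IsFrame e → ∀ φ ∈ IsManifold.maximalAtlas 𝓘(ℂ, ℂ) ω X,
          ∀ x ∈ e.baseSet ∩ φ.source, ∀ᶠ z in 𝓝[≠] (φ x),
            h (φ.symm z) = localWronskian e φ A z / localWronskian e φ B z ∧
            h (φ.symm z) = (localQuotient e φ A B z).det) ∧
    -- the class of `div A` in the Picard group is independent of `A`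
    (∀ A B : (∀ x, E x), P.IsGeneric A → P.IsGeneric B →
      ∀ DA DB : Divisor X, P.IsWronskianDivisor A DA → P.IsWronskianDivisor B DB →
      DA.picClass = DB.picClass) ∧
    -- the Wronskian line bundle of `E` is well defined (it does not even depend on the choice of
    -- the projectively flat structure)
    ((∃ A : (∀ x, E x), P.IsGeneric A) →
      ∃! c : Pic X, ∀ (Q : ProjFlatStructure n E) (A : ∀ x, E x) (D : Divisor X),
        Q.IsGeneric A → Q.IsWronskianDivisor A D → D.picClass = c) := by

  refine ⟨fun A hA => hA.existsUnique_isWronskianDivisor, fun A B hA hB DA DB hDA hDB =>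
    ⟨ProjFlatStructure.wronskianQuotient P P A B,
      ProjFlatStructure.hasDivisor_wronskianQuotient hA.1 hB.1 hDA hDB,
      fun e he φ hφ x hx => ?_⟩, fun A B hA hB DA DB hDA hDB =>
    (ProjFlatStructure.hasDivisor_wronskianQuotient hA.1 hB.1 hDA hDB).picClass_eq, ?_⟩
  · filter_upwards [he.eventually_wronskianQuotient_eq he hφ hx.1 hx.1 hx.2 hA.1 hB.1,
      nhdsWithin_le_nhds (eventually_symm_mem hx.2 (e.open_baseSet.mem_nhds hx.1))] with z hz hze
    -- With the same frame for `A` and `B` the determinant factor is `1`.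
    rw [det_localQuotient, and_self, hz, transitionMatrix_self hze, Matrix.det_one, one_mul]
  · rintro ⟨A, hA⟩
    obtain ⟨D, hD, -⟩ := hA.existsUnique_isWronskianDivisor
    -- A section generic for any `Q` is compared directly with `A`, generic for `P`; uniqueness
    -- comes from evaluating a candidate class at `A`.
    exact ⟨D.picClass, fun Q B D' hB hD' =>
      (ProjFlatStructure.hasDivisor_wronskianQuotient hB.1 hA.1 hD' hD).picClass_eq,
      fun c hc => (hc P A D hA hD).symm⟩
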